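/- Fix an integer $p\ge 1$, real numbers $\alpha,\beta$, and $\nu=(\nu_1,\nu_2)\in\mathbb{Q}^2$ with $\nu_1,\nu_2>0$. **Matrices.** For $n\ge 1$ let $\xi_1=\dots=\xi_{p+1}=0$, $\xi_{i+p+1}=i/n$ ($0\le i\le n$), $\xi_{p+n+1}=\dots=\xi_{2p+n+1}=1$, and let $N_i^0$ be the indicator function of $[\xi_i,\xi_{i+1})$ and $$N_i^k(x)=\frac{x-\xi_i}{\xi_{i+k}-\xi_i}N_i^{k-1}(x)+\frac{\xi_{i+k+1}-x}{\xi_{i+k+1}-\xi_{i+1}}N_{i+1}^{k-1}(x),\qquad 1\le k\le p,$$ where fractions with zero denominator are zero. Define the $(n+p-2)\times(n+p-2)$ matrices $$M_n^p=\Big[\int_0^1 N_{i+1}^pN_{j+1}^p\Big]_{i,j},\quad A_n^p=\Big[\int_0^1 N_{i+1}^p(N_{j+1}^p)'\Big]_{i,j},\quad S_n^p=\Big[\int_0^1 (N_{i+1}^p)'(N_{j+1}^p)'\Big]_{i,j},$$ and, for $\boldsymbol n=(n_1,n_2)$, the IgA matrix of $\alpha(\nabla\times u,\nabla\times v)+\beta(\nabla\cdot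 u,\nabla\cdot v)$ on $(0,1)^2$ with homogeneous Dirichlet conditions, $$\mathcal A^{p,\alpha,\beta}_{\boldsymbol n}=\alpha\begin{bmatrix} M^p_{n_1}\otimes S^p_{n_2} & -(A^p_{n_1})^T\otimes A^p_{n_2}\\ -A^p_{n_1}\otimes (A^p_{n_2})^T & S^p_{n_1}\otimes M^p_{n_2}\end{bmatrix}+\beta\begin{bmatrix} S^p_{n_1}\otimes M^p_{n_2} & A^p_{n_1}\otimes (A^p_{n_2})^T\\ (A^p_{n_1})^T\otimes A^p_{n_2} & M^p_{n_1}\otimes S^p_{n_2}\end{bmatrix},$$ of size $d_{\boldsymbol n}=2(n_1+p-2)(n_2+p-2)$. **Symbol.** Let $\phi_0$ be the indicator function of $[0,1)$, $\phi_r(t)=\frac{t}{r}\phi_{r-1}(t)+\frac{r+1-t}{r}\phi_{r-1}(t-1)$ for $r\ge1$, and $$\mathfrak m_p(\theta)=\phi_{2p+1}(p+1)+2\sum_{k=1}^p\phi_{2p+1}(p+1-k)\cos(k\theta),\qquad \mathfrak a_p(\theta)=-2\sum_{k=1}^p\phi_{2p+1}'(p+1-k)\sin(k\theta),$$ $$\mathfrak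 s_p(\theta)=-\phi_{2p+1}''(p+1)-2\sum_{k=1}^p\phi_{2p+1}''(p+1-k)\cos(k\theta).$$ Let $f^{p,\alpha,\beta}:[-\pi,\pi]^2\to\mathbb C^{2\times2}$ be the matrix-valued function with entries $$f_{1,1}=\alpha\tfrac{\nu_2}{\nu_1}\mathfrak m_p(\theta_1)\mathfrak s_p(\theta_2)+\beta\tfrac{\nu_1}{\nu_2}\mathfrak s_p(\theta_1)\mathfrak m_p(\theta_2),\qquad f_{2,2}=\alpha\tfrac{\nu_1}{\nu_2}\mathfrak s_p(\theta_1)\mathfrak m_p(\theta_2)+\beta\tfrac{\nu_2}{\nu_1}\mathfrak m_p(\theta_1)\mathfrak s_p(\theta_2),$$ $$f_{1,2}=f_{2,1}=-(\alpha-\beta)\,\mathfrak a_p(\theta_1)\mathfrak a_p(\theta_2).$$ **Theorem.** As $n\to\infty$ through the natural numbers $n$ for which $\boldsymbol n=(n_1,n_2)=(n\nu_1,n\nu_2)\in\mathbb N^2$, the matrices $\mathcal A^{p,\alpha,\beta}_{\boldsymbol n}$ have spectral symbol $f^{p,\alpha,\beta}$ in the sense of the eigenvalues on $[-\pi,\pi]^2$.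 That is, $d_{\boldsymbol n}\to\infty$, and for every continuous compactly supported $F:\mathbb C\to\mathbb C$, $$\lim_{n\to\infty}\frac1{d_{\boldsymbol n}}\sum_{j=1}^{d_{\boldsymbol n}}F\big(\lambda_j(\mathcal A^{p,\alpha,\beta}_{\boldsymbol n})\big)=\frac1{(2\pi)^2}\int_{[-\pi,\pi]^2}\frac{F(\lambda_1(f^{p,\alpha,\beta}(\theta)))+F(\lambda_2(f^{p,\alpha,\beta}(\theta)))}{2}\,d\theta,$$ where $\lambda_j(\cdot)$ denotes the eigenvalues of a matrix, counted with algebraic multiplicity. -/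

import Mathlib

open Filter MeasureTheory Topology
open scoped Kronecker

noncomputable section

namespace CurlDiv

/-! ### Spectral distribution -/

/-- `SpectralSymbol l A f G` : the family of matrices `A i`, of size `Fintype.card (κ i)`,
is distributed as the pair `(f, G)` in the sense of the eigenvalues along the filter `l`.
Eigenvalues are counted with algebraic multiplicity, as the roots of the characteristic
polynomial over `ℂ`. -/
structure SpectralSymbol {ι : Type*} (l : Filter ι) {κ : ι → Type*}
    [∀ i, Fintype (κ i)] [∀ i, DecidableEq (κ i)]
    (A : (i : ι) → Matrix (κ i) (κ i) ℂ) {q s : ℕ}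
    (f : (Fin q → ℝ) → Matrix (Fin s) (Fin s) ℂ) (G : Set (Fin q → ℝ)) : Prop where
  measurableSet_domain : MeasurableSet G
  volume_pos : 0 < volume G
  volume_lt_top : volume G < ⊤
  measurable_symbol : ∀ i j, Measurable (G.domRestrict fun t => f t i j)
  tendsto_dim : Tendsto (fun i => Fintype.card (κ i)) l atTop
  integrableOn : ∀ F : ℂ → ℂ, Continuous F → HasCompactSupport F →
    IntegrableOn (fun t => ((f t).charpoly.roots.map F).sum / (s : ℂ)) G
  tendsto_sum : ∀ F : ℂ → ℂ, Continuous F → HasCompactSupport F →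
    Tendsto
      (fun i => ((A i).charpoly.roots.map F).sum / (Fintype.card (κ i) : ℂ)) l
      (𝓝 ((1 / (volume.real G : ℂ)) * ∫ t in G, ((f t).charpoly.roots.map F).sum / (s : ℂ)))

/-- The regime `(n₁, n₂) = (n ν₁, n ν₂)`, `n ∈ ℕ`, with `n₁, n₂ → ∞` : only those `n` occur
for which both `n ν₁` and `n ν₂` are natural numbers. -/
def multiplesAtTop (ν₁ ν₂ : ℚ) : Filter (ℕ × ℕ) :=
  atTop ⊓ 𝓟 {N | ∃ n : ℕ, (N.1 : ℚ) = n * ν₁ ∧ (N.2 : ℚ) = n * ν₂}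

/-! ### B-splines -/

/-- The uniform open knot sequence `ξ_1, …, ξ_{2p+n+1}` on `[0,1]`
(degree `p`, `n` intervals, indices starting at `1`). -/
def knot (p n i : ℕ) : ℝ :=
  if i ≤ p + 1 then 0
  else if i ≤ p + n then ((i : ℝ) - (p + 1)) / n
  else 1

/-- `bsplineAux p n k i` is the function `N_i^k` over the knots `knot p n`.
Division by zero gives zero, as the recursion requires. -/
def bsplineAux (p n : ℕ) : ℕ → ℕ → ℝ → ℝ
  | 0, i, x => if knot p n i ≤ x ∧ x < knot p n (i + 1) then 1 else 0
  | k + 1, i, x =>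
      (x - knot p n i) / (knot p n (i + (k + 1)) - knot p n i) * bsplineAux p n k i x
      + (knot p n (i + (k + 1) + 1) - x) / (knot p n (i + (k + 1) + 1) - knot p n (i + 1))
          * bsplineAux p n k (i + 1) x

/-- The B-spline `N_i^p`, `i = 1, …, n + p`, of degree `p` over the uniform mesh of `[0,1]`
with `n` intervals. -/
def bspline (p n i : ℕ) : ℝ → ℝ := bsplineAux p n p i

/-- The cardinal B-spline `φ_p` of degree `p`. -/
def cardinalBSpline : ℕ → ℝ → ℝ
  | 0, t => if 0 ≤ t ∧ t < 1 then 1 else 0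
  | p + 1, t =>
      t / ((p + 1 : ℕ) : ℝ) * cardinalBSpline p t
      + (((p + 1 : ℕ) : ℝ) + 1 - t) / ((p + 1 : ℕ) : ℝ) * cardinalBSpline p (t - 1)

/-! ### Mass, advection and stiffness matrices

A row or column index `i : Fin (n + p - 2)` (starting at `0`) stands for the interior B-spline
`N_{i+2}^p`; thus the B-splines `N_2^p, …, N_{n+p-1}^p` occur. -/

/-- The mass matrix `M_n^p`. -/
def massMatrix (p n : ℕ) : Matrix (Fin (n + p - 2)) (Fin (n + p - 2)) ℝ :=
  Matrix.of fun i j => ∫ x in (0 : ℝ)..1, bspline p n (i + 2) x * bspline p n (j + 2) x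

/-- The advection matrix `A_n^p`. -/
def advectionMatrix (p n : ℕ) : Matrix (Fin (n + p - 2)) (Fin (n + p - 2)) ℝ :=
  Matrix.of fun i j => ∫ x in (0 : ℝ)..1, bspline p n (i + 2) x * deriv (bspline p n (j + 2)) x

/-- The stiffness matrix `S_n^p`. -/
def stiffnessMatrix (p n : ℕ) : Matrix (Fin (n + p - 2)) (Fin (n + p - 2)) ℝ :=
  Matrix.of fun i j =>
    ∫ x in (0 : ℝ)..1, deriv (bspline p n (i + 2)) x * deriv (bspline p n (j + 2)) x

/-! ### The curl-div matrices -/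

/-- Index set of the `2 × 2` block matrices; it has `2 m₁ m₂` elements, `m_l = n_l + p - 2`. -/
abbrev Index (p n₁ n₂ : ℕ) : Type :=
  (Fin (n₁ + p - 2) × Fin (n₂ + p - 2)) ⊕ (Fin (n₁ + p - 2) × Fin (n₂ + p - 2))

/-- Discretization of the form `(∇ × u, ∇ × v)`. -/
def curlMatrix (p n₁ n₂ : ℕ) : Matrix (Index p n₁ n₂) (Index p n₁ n₂) ℝ :=
  Matrix.fromBlocks
    (massMatrix p n₁ ⊗ₖ stiffnessMatrix p n₂)
    (-((advectionMatrix p n₁).transpose ⊗ₖ advectionMatrix p n₂))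
    (-(advectionMatrix p n₁ ⊗ₖ (advectionMatrix p n₂).transpose))
    (stiffnessMatrix p n₁ ⊗ₖ massMatrix p n₂)

/-- Discretization of the form `(∇ · u, ∇ · v)`. -/
def divMatrix (p n₁ n₂ : ℕ) : Matrix (Index p n₁ n₂) (Index p n₁ n₂) ℝ :=
  Matrix.fromBlocks
    (stiffnessMatrix p n₁ ⊗ₖ massMatrix p n₂)
    (advectionMatrix p n₁ ⊗ₖ (advectionMatrix p n₂).transpose)
    ((advectionMatrix p n₁).transpose ⊗ₖ advectionMatrix p n₂)
    (massMatrix p n₁ ⊗ₖ stiffnessMatrix p n₂)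

/-- The coefficient matrix of the form `α (∇ × u, ∇ × v) + β (∇ · u, ∇ · v)`. -/
def curlDivMatrix (p : ℕ) (α β : ℝ) (n₁ n₂ : ℕ) : Matrix (Index p n₁ n₂) (Index p n₁ n₂) ℝ :=
  α • curlMatrix p n₁ n₂ + β • divMatrix p n₁ n₂

/-! ### The symbol -/

/-- The symbol `𝔪_p` of the mass matrices. -/
def symbolM (p : ℕ) (θ : ℝ) : ℝ :=
  cardinalBSpline (2 * p + 1) ((p : ℝ) + 1)
    + 2 * ∑ k ∈ Finset.Icc 1 p,
        cardinalBSpline (2 * p + 1) ((p : ℝ) + 1 - k) * Real.cos (k * θ)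

/-- The symbol `𝔞_p` of the advection matrices. -/
def symbolA (p : ℕ) (θ : ℝ) : ℝ :=
  -2 * ∑ k ∈ Finset.Icc 1 p,
        deriv (cardinalBSpline (2 * p + 1)) ((p : ℝ) + 1 - k) * Real.sin (k * θ)

/-- The symbol `𝔰_p` of the stiffness matrices. -/
def symbolS (p : ℕ) (θ : ℝ) : ℝ :=
  -iteratedDeriv 2 (cardinalBSpline (2 * p + 1)) ((p : ℝ) + 1)
    - 2 * ∑ k ∈ Finset.Icc 1 p,
        iteratedDeriv 2 (cardinalBSpline (2 * p + 1)) ((p : ℝ) + 1 - k) * Real.cos (k * θ)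

/-- The `2 × 2` matrix-valued symbol `f^{p,α,β}` (with real entries). -/
def curlDivSymbol (p : ℕ) (α β : ℝ) (ν₁ ν₂ : ℚ) (θ : Fin 2 → ℝ) : Matrix (Fin 2) (Fin 2) ℝ :=
  !![α * ((ν₂ : ℝ) / ν₁) * symbolM p (θ 0) * symbolS p (θ 1)
        + β * ((ν₁ : ℝ) / ν₂) * symbolS p (θ 0) * symbolM p (θ 1),
      -(α - β) * symbolA p (θ 0) * symbolA p (θ 1);
     -(α - β) * symbolA p (θ 0) * symbolA p (θ 1),
      α * ((ν₁ : ℝ) / ν₂) * symbolS p (θ 0) * symbolM p (θ 1)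
        + β * ((ν₂ : ℝ) / ν₁) * symbolM p (θ 0) * symbolS p (θ 1)]

end CurlDiv

end

/-!
The matrices are real symmetric and, with the mesh ratio fixed, have uniformly bounded row sums.
Their eigenvalues therefore lie in a fixed interval, and by Weierstrass' theorem it suffices to
prove the convergence of all moments `tr (A ^ k) / d` (`tendsto_eigenvalueSum_of_moments`).

The B-splines `N_i` with `p + 1 ≤ i ≤ n` are scaled translates of the cardinal B-spline `φ_p`
(`bsplineAux_eq_cardinalBSpline`). The correlation of `φ_p` with itself is `φ_{2p+1}`
(`integral_cardinalBSpline_mul`), so the interior entries of the scaled mass, advection and stiffness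
matrices are the Fourier coefficients of `𝔪_p`, `i 𝔞_p` and `𝔰_p`
(`isBandedToeplitz_massMatrix` and the two lemmas after it). Near the boundary only the
bandwidth and a bound on the entries are needed; the bound comes from the recursion, which gives
`|N_i| ≤ 2 ^ p` and `|N_i'| ≤ p 2 ^ p n` off the grid.

A row away from the boundary thus acts on plane waves as multiplication by the symbol `f`, and by
induction a row at distance of order `k p` from the boundary has
`(A ^ k)_{ij} = (2 π)⁻² ∫ f(θ) ^ k exp(i (j - i) θ) dθ` (`pow_apply_eq_integral`). The remaining
`O(n₁ + n₂)` diagonal entries of `A ^ k` are bounded and do not influence the limit of the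
normalized trace (`tendsto_trace_pow`).
-/

noncomputable section

namespace CurlDiv

/-! ### Cardinal B-splines -/

lemma cardinalBSpline_succ (r : ℕ) (t : ℝ) :
    cardinalBSpline (r + 1) t = t / ((r : ℝ) + 1) * cardinalBSpline r t
      + ((r : ℝ) + 2 - t) / ((r : ℝ) + 1) * cardinalBSpline r (t - 1) := by
  rw [cardinalBSpline]; push_cast; ring

lemma cardinalBSpline_of_neg (r : ℕ) {t : ℝ} (ht : t < 0) : cardinalBSpline r t = 0 := by
  induction r generalizing t with
  | zero => simp [cardinalBSpline, ht.not_ge]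
  | succ r ih => rw [cardinalBSpline_succ, ih ht, ih (by linarith)]; ring

lemma cardinalBSpline_of_ge (r : ℕ) {t : ℝ} (ht : (r : ℝ) + 1 ≤ t) : cardinalBSpline r t = 0 := by
  induction r generalizing t with
  | zero => simp at ht; simp [cardinalBSpline, ht.not_gt]
  | succ r ih =>
    push_cast at ht
    rw [cardinalBSpline_succ, ih (by linarith), ih (by linarith)]; ring

lemma measurable_cardinalBSpline (r : ℕ) : Measurable (cardinalBSpline r) := by
  induction r with
  | zero =>
    exact Measurable.ite (measurableSet_Ico (a := (0 : ℝ)) (b := 1)) measurable_const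
      measurable_const
  | succ r ih =>
    have : cardinalBSpline (r + 1) = fun t => t / ((r : ℝ) + 1) * cardinalBSpline r t
      + ((r : ℝ) + 2 - t) / ((r : ℝ) + 1) * cardinalBSpline r (t - 1) :=
        funext (cardinalBSpline_succ r)
    rw [this]
    fun_prop

lemma abs_cardinalBSpline_le (r : ℕ) (t : ℝ) : |cardinalBSpline r t| ≤ 2 ^ r := by
  induction r generalizing t with
  | zero => rw [cardinalBSpline]; split_ifs <;> simp
  | succ r ih =>
    have hr : (0 : ℝ) < r + 1 := by positivity
    -- on the support of the second factor, the affine weight lies in `[0, 1]`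
    have key : ∀ c u : ℝ, (0 ≤ u → u < r + 1 → |c| ≤ 1) →
        |c * cardinalBSpline r u| ≤ 2 ^ r := by
      intro c u h
      rw [abs_mul]
      by_cases h0 : u < 0
      · rw [cardinalBSpline_of_neg r h0]; simp
      by_cases h1 : (r : ℝ) + 1 ≤ u
      · rw [cardinalBSpline_of_ge r h1]; simp
      calc _ ≤ 1 * (2 : ℝ) ^ r :=
            mul_le_mul (h (by linarith) (by linarith)) (ih u) (abs_nonneg _) zero_le_one
        _ = _ := one_mul _
    rw [cardinalBSpline_succ, pow_succ, mul_two]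
    refine (abs_add_le _ _).trans (add_le_add (key _ _ fun h0 h1 => ?_) (key _ _ fun h0 h1 => ?_))
    · rw [abs_le]; constructor
      · have : 0 ≤ t / ((r : ℝ) + 1) := by positivity
        linarith
      · rw [div_le_one hr]; linarith
    · rw [abs_le]; constructor
      · have : 0 ≤ ((r : ℝ) + 2 - t) / ((r : ℝ) + 1) := div_nonneg (by linarith) hr.le
        linarith
      · rw [div_le_one hr]; linarith

lemma continuous_cardinalBSpline (r : ℕ) : Continuous (cardinalBSpline (r + 1)) := by
  induction r with
  | zero =>
    have : cardinalBSpline 1 = fun t => max 0 (min t (2 - t)) := by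
      funext t
      rw [cardinalBSpline_succ]
      simp only [cardinalBSpline]
      rcases lt_or_ge t 0 with h0 | h0
      · have : ¬ (0 ≤ t) := by linarith
        have h2 : ¬ (0 ≤ t - 1) := by linarith
        rw [min_eq_left (by linarith), max_eq_left (by linarith)]
        simp [this, h2]
      rcases lt_or_ge t 1 with h1 | h1
      · have h2 : ¬ (0 ≤ t - 1) := by linarith
        rw [min_eq_left (by linarith), max_eq_right (by linarith)]
        simp only [h0, h1, h2]; simp
      rcases lt_or_ge t 2 with h3 | h3
      · have h2 : (0 ≤ t - 1) := by linarith
        have h4 : t - 1 < 1 := by linarith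
        have h5 : ¬ t < 1 := by linarith
        rw [min_eq_right (by linarith), max_eq_right (by linarith)]
        simp only [h0, h2, h4, h5]; simp
      · have h4 : ¬ t - 1 < 1 := by linarith
        have h5 : ¬ t < 1 := by linarith
        rw [min_eq_right (by linarith), max_eq_left (by linarith)]
        simp [h4, h5]
    rw [zero_add, this]; fun_prop
  | succ r ih =>
    have : cardinalBSpline (r + 1 + 1) = fun t => t / (((r + 1 : ℕ) : ℝ) + 1) *
        cardinalBSpline (r + 1) t
      + (((r + 1 : ℕ) : ℝ) + 2 - t) / (((r + 1 : ℕ) : ℝ) + 1) * cardinalBSpline (r + 1) (t - 1) :=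
        funext (cardinalBSpline_succ (r + 1))
    rw [this]
    fun_prop

/-- Symmetry about the midpoint of the support. It fails for `r = 0`, at the two end points. -/
lemma cardinalBSpline_symm (r : ℕ) (t : ℝ) :
    cardinalBSpline (r + 1) ((r : ℝ) + 2 - t) = cardinalBSpline (r + 1) t := by
  induction r generalizing t with
  | zero =>
    rw [cardinalBSpline_succ, cardinalBSpline_succ]
    simp only [cardinalBSpline]
    rcases lt_trichotomy t 0 with h | rfl | h
    · rw [if_neg, if_neg, if_neg, if_neg] 
      · simp
      all_goals push_cast; intro h'; linarith [h'.1, h'.2]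
    · norm_num
    rcases lt_trichotomy t 1 with h1 | rfl | h1
    · rw [if_neg, if_pos, if_pos, if_neg]
      · push_cast; ring
      · intro h; linarith [h.1]
      · constructor <;> linarith
      · constructor <;> push_cast <;> linarith
      · push_cast; intro h; linarith [h.2]
    · norm_num
    rcases lt_trichotomy t 2 with h2 | rfl | h2
    · rw [if_pos, if_neg, if_neg, if_pos]
      · push_cast; ring
      · constructor <;> linarith
      · intro h; linarith [h.2]
      · push_cast; intro h; linarith [h.1]
      · constructor <;> push_cast <;> linarith
    · norm_num
    · rw [if_neg, if_neg, if_neg, if_neg] 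
      · simp
      all_goals push_cast; intro h'; linarith [h'.1, h'.2]
  | succ r ih =>
    rw [cardinalBSpline_succ (r + 1), cardinalBSpline_succ (r + 1) t]
    have h1 : ((r + 1 : ℕ) : ℝ) + 2 - t = (r : ℝ) + 2 - (t - 1) := by push_cast; ring
    have h2 : ((r + 1 : ℕ) : ℝ) + 2 - t - 1 = (r : ℝ) + 2 - t := by push_cast; ring
    rw [h2, ih, h1, ih]
    push_cast
    ring

/-- The derivative formula `φ_{r+1}'(t) = φ_r(t) - φ_r(t - 1)` away from the knots. The induction
step is an algebraic identity between values of `φ_{r}` in the recursion. -/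
lemma hasDerivAt_cardinalBSpline_of_notMem (r : ℕ) {t : ℝ} (ht : t ∉ Set.range ((↑) : ℤ → ℝ)) :
    HasDerivAt (cardinalBSpline (r + 1)) (cardinalBSpline r t - cardinalBSpline r (t - 1)) t := by
  have shift : ∀ s : ℝ, s ∉ Set.range ((↑) : ℤ → ℝ) → s - 1 ∉ Set.range ((↑) : ℤ → ℝ) := by
    rintro s hs ⟨m, hm⟩
    exact hs ⟨m + 1, by push_cast; linarith⟩
  have step : ∀ (t : ℝ) (q : ℕ) (d₁ d₂ : ℝ), HasDerivAt (cardinalBSpline q) d₁ t →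
      HasDerivAt (cardinalBSpline q) d₂ (t - 1) →
      HasDerivAt (cardinalBSpline (q + 1))
        (1 / ((q : ℝ) + 1) * cardinalBSpline q t + t / ((q : ℝ) + 1) * d₁
          + ((-1) / ((q : ℝ) + 1) * cardinalBSpline q (t - 1)
            + ((q : ℝ) + 2 - t) / ((q : ℝ) + 1) * d₂)) t := by
    intro t q d₁ d₂ h₁ h₂
    have h₂' : HasDerivAt (fun s => cardinalBSpline q (s - 1)) d₂ t := h₂.comp_sub_const t 1
    have e₁ : HasDerivAt (fun s : ℝ => s / ((q : ℝ) + 1)) (1 / ((q : ℝ) + 1)) t :=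
      (hasDerivAt_id t).div_const _
    have e₂ : HasDerivAt (fun s : ℝ => ((q : ℝ) + 2 - s) / ((q : ℝ) + 1))
        ((-1) / ((q : ℝ) + 1)) t := ((hasDerivAt_id t).const_sub _).div_const _
    have := (e₁.mul h₁).add (e₂.mul h₂')
    rw [show cardinalBSpline (q + 1) = _ from funext (cardinalBSpline_succ q)]
    exact this
  induction r generalizing t with
  | zero =>
    have h0 : ∀ s : ℝ, s ∉ Set.range ((↑) : ℤ → ℝ) → HasDerivAt (cardinalBSpline 0) 0 s := by
      intro s hs
      have n0 : s ≠ 0 := fun h => hs ⟨0, by simp [h]⟩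
      have n1 : s ≠ 1 := fun h => hs ⟨1, by simp [h]⟩
      have : ∃ c : ℝ, cardinalBSpline 0 =ᶠ[𝓝 s] fun _ => c := by
        rcases lt_or_gt_of_ne n0 with h | h
        · exact ⟨0, (eventually_lt_nhds h).mono fun x hx => cardinalBSpline_of_neg 0 hx⟩
        rcases lt_or_gt_of_ne n1 with h' | h'
        · refine ⟨1, ?_⟩
          filter_upwards [eventually_lt_nhds h', eventually_gt_nhds h] with x hx hx'
          rw [cardinalBSpline, if_pos ⟨hx'.le, hx⟩]
        · refine ⟨0, (eventually_gt_nhds h').mono fun x hx =>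
            cardinalBSpline_of_ge 0 (by simpa using hx.le)⟩
      obtain ⟨c, hc⟩ := this
      exact (hasDerivAt_const s c).congr_of_eventuallyEq hc
    have := step t 0 0 0 (h0 t ht) (h0 _ (shift t ht))
    convert this using 1
    simp
    ring
  | succ r ih =>
    have := step t (r + 1) _ _ (ih ht) (ih (shift t ht))
    convert this using 1
    have hr : (r : ℝ) + 1 ≠ 0 := by positivity
    have hr2 : (r : ℝ) + 1 + 1 ≠ 0 := by positivity
    rw [cardinalBSpline_succ r t, cardinalBSpline_succ r (t - 1)]
    push_cast
    field_simp
    ring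

lemma ae_notMem_range_intCast : ∀ᵐ t : ℝ, t ∉ Set.range ((↑) : ℤ → ℝ) :=
  (Set.countable_range _).ae_notMem _

lemma integrable_cardinalBSpline (r : ℕ) : Integrable (cardinalBSpline r) := by
  have h : Integrable (Set.indicator (Set.Icc (0 : ℝ) (r + 1)) fun _ => (2 : ℝ) ^ r) :=
    (integrable_indicator_iff measurableSet_Icc).2 (by simp)
  refine h.mono' (measurable_cardinalBSpline r).aestronglyMeasurable (ae_of_all _ fun t => ?_)
  by_cases ht : t ∈ Set.Icc (0 : ℝ) (r + 1)
  · simpa [Set.indicator_of_mem ht] using abs_cardinalBSpline_le r t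
  · rw [Set.indicator_of_notMem ht]
    rw [Set.mem_Icc, not_and_or, not_le, not_le] at ht
    rcases ht with h | h
    · simp [cardinalBSpline_of_neg r h]
    · simp [cardinalBSpline_of_ge r h.le]

/-- The integrated form of the derivative formula. The exceptional knots are countable, and the
fundamental theorem of calculus tolerates them since `φ_{r+1}` is continuous. -/
lemma cardinalBSpline_succ_eq_integral (r : ℕ) (t : ℝ) :
    cardinalBSpline (r + 1) t = ∫ s in (t - 1)..t, cardinalBSpline r s := by
  have hi : ∀ a b : ℝ, IntervalIntegrable (cardinalBSpline r) volume a b :=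
    fun a b => (integrable_cardinalBSpline r).intervalIntegrable
  have hi' : ∀ a b : ℝ, IntervalIntegrable (fun s => cardinalBSpline r (s - 1)) volume a b :=
    fun a b => ((integrable_cardinalBSpline r).comp_sub_right 1).intervalIntegrable
  have hneg : ∀ a b : ℝ, a ≤ 0 → b ≤ 0 → ∫ s in a..b, cardinalBSpline r s = 0 := by
    intro a b ha hb
    refine intervalIntegral.integral_zero_ae ?_
    filter_upwards [ae_notMem_range_intCast] with s hs hmem
    have : s ≤ 0 := hmem.2.trans (max_le ha hb)
    exact cardinalBSpline_of_neg r (lt_of_le_of_ne this fun h => hs ⟨0, by simp [h]⟩)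
  have h := integral_eq_of_hasDerivAt_off_countable (cardinalBSpline (r + 1))
    (fun s => cardinalBSpline r s - cardinalBSpline r (s - 1)) (a := -1) (b := t)
    (Set.countable_range ((↑) : ℤ → ℝ)) (continuous_cardinalBSpline r).continuousOn
    (fun x hx => hasDerivAt_cardinalBSpline_of_notMem r hx.2) ((hi _ _).sub (hi' _ _))
  rw [intervalIntegral.integral_sub (hi _ _) (hi' _ _),
    intervalIntegral.integral_comp_sub_right (fun s => cardinalBSpline r s),
    cardinalBSpline_of_neg (r + 1) (by norm_num : (-1 : ℝ) < 0), sub_zero] at h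
  rw [← h, intervalIntegral.integral_interval_sub_interval_comm (hi _ _) (hi _ _) (hi _ _),
    hneg (-1) (-1 - 1) (by norm_num) (by norm_num), zero_sub, intervalIntegral.integral_symm,
    neg_neg]

lemma hasDerivAt_cardinalBSpline (r : ℕ) (t : ℝ) :
    HasDerivAt (cardinalBSpline (r + 2))
      (cardinalBSpline (r + 1) t - cardinalBSpline (r + 1) (t - 1)) t := by
  have hc := continuous_cardinalBSpline r
  have hi : ∀ a b : ℝ, IntervalIntegrable (cardinalBSpline (r + 1)) volume a b :=
    fun a b => hc.intervalIntegrable a b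
  have hF : ∀ s, HasDerivAt (fun u => ∫ x in (0 : ℝ)..u, cardinalBSpline (r + 1) x)
      (cardinalBSpline (r + 1) s) s := fun s =>
    intervalIntegral.integral_hasDerivAt_right (hi _ _)
      (hc.stronglyMeasurableAtFilter _ _) hc.continuousAt
  have e : cardinalBSpline (r + 2) = fun t => (∫ x in (0 : ℝ)..t, cardinalBSpline (r + 1) x) -
      ∫ x in (0 : ℝ)..(t - 1), cardinalBSpline (r + 1) x := by
    funext t
    rw [cardinalBSpline_succ_eq_integral, intervalIntegral.integral_interval_sub_left
      (hi _ _) (hi _ _)]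
  rw [e]
  exact (hF t).sub ((hF (t - 1)).comp_sub_const t 1)

lemma deriv_cardinalBSpline (r : ℕ) : deriv (cardinalBSpline (r + 2)) =
    fun t => cardinalBSpline (r + 1) t - cardinalBSpline (r + 1) (t - 1) :=
  funext fun t => (hasDerivAt_cardinalBSpline r t).deriv

lemma iteratedDeriv_two_cardinalBSpline (r : ℕ) (t : ℝ) :
    iteratedDeriv 2 (cardinalBSpline (r + 3)) t = cardinalBSpline (r + 1) t
      - 2 * cardinalBSpline (r + 1) (t - 1) + cardinalBSpline (r + 1) (t - 2) := by
  rw [iteratedDeriv_succ, iteratedDeriv_one, deriv_cardinalBSpline]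
  have h := (hasDerivAt_cardinalBSpline r t).sub
    ((hasDerivAt_cardinalBSpline r (t - 1)).comp_sub_const t 1)
  refine h.deriv.trans ?_
  rw [show t - 1 - 1 = t - 2 by ring]
  ring

/-! ### Correlation of cardinal B-splines -/

/-- The cross-correlation of two cardinal B-splines is a cardinal B-spline. The induction is on
the degree of the second factor, by Fubini and `φ_{q+1}(t) = ∫₀¹ φ_q(t - s) ds`. -/
lemma integral_cardinalBSpline_mul (r q : ℕ) (z : ℝ) :
    ∫ y, cardinalBSpline r y * cardinalBSpline q (y + z)
      = cardinalBSpline (r + q + 1) (r + 1 + z) := by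
  have hunit : ∀ (q : ℕ) (t : ℝ),
      cardinalBSpline (q + 1) t = ∫ s in (0 : ℝ)..1, cardinalBSpline q (t - s) := by
    intro q t
    rw [intervalIntegral.integral_comp_sub_left (fun s => cardinalBSpline q s), sub_zero,
      cardinalBSpline_succ_eq_integral]
  induction q generalizing z with
  | zero =>
    have e : (fun y => cardinalBSpline r y * cardinalBSpline 0 (y + z))
        = Set.indicator (Set.Ico (-z) (1 - z)) (cardinalBSpline r) := by
      funext y
      by_cases hy : y ∈ Set.Ico (-z) (1 - z)
      · rw [Set.indicator_of_mem hy, cardinalBSpline,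
          if_pos ⟨by linarith [hy.1], by linarith [hy.2]⟩, mul_one]
      · rw [Set.indicator_of_notMem hy, cardinalBSpline,
          if_neg fun h => hy ⟨by linarith [h.1], by linarith [h.2]⟩, mul_zero]
    rw [e, integral_indicator measurableSet_Ico, integral_Ico_eq_integral_Ioc,
      ← intervalIntegral.integral_of_le (by linarith), add_zero, ← cardinalBSpline_symm,
      cardinalBSpline_succ_eq_integral]
    congr 1 <;> ring
  | succ q ih =>
    have : IsFiniteMeasure (volume.restrict (Set.uIoc (0 : ℝ) 1)) := by
      rw [Set.uIoc_of_le zero_le_one]; infer_instance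
    have hint : Integrable (Function.uncurry fun s y : ℝ =>
        cardinalBSpline r y * cardinalBSpline q (y + z - s))
        ((volume.restrict (Set.uIoc 0 1)).prod volume) := by
      have h1 : Integrable (fun x : ℝ × ℝ => cardinalBSpline r x.2)
          ((volume.restrict (Set.uIoc 0 1)).prod volume) :=
        (integrable_cardinalBSpline r).comp_snd _
      refine h1.mul_bdd (c := 2 ^ q) ?_ (ae_of_all _ fun x => abs_cardinalBSpline_le q _)
      exact ((measurable_cardinalBSpline q).comp (by fun_prop)).aestronglyMeasurable
    calc ∫ y, cardinalBSpline r y * cardinalBSpline (q + 1) (y + z)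
        = ∫ y, ∫ s in (0 : ℝ)..1, cardinalBSpline r y * cardinalBSpline q (y + z - s) := by
          simp_rw [intervalIntegral.integral_const_mul, hunit]
      _ = ∫ s in (0 : ℝ)..1, ∫ y, cardinalBSpline r y * cardinalBSpline q (y + z - s) :=
          (intervalIntegral_integral_swap hint).symm
      _ = ∫ s in (0 : ℝ)..1, cardinalBSpline (r + q + 1) (r + 1 + z - s) := by
          simp_rw [add_sub_assoc, ih]
      _ = _ := by rw [← hunit]; rfl

lemma integrable_cardinalBSpline_mul (r q : ℕ) (w z : ℝ) :
    Integrable fun y => cardinalBSpline r (y + w) * cardinalBSpline q (y + z) :=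
  ((integrable_cardinalBSpline r).comp_add_right w).mul_bdd (c := 2 ^ q)
    ((measurable_cardinalBSpline q).comp (by fun_prop)).aestronglyMeasurable
    (ae_of_all _ fun _ => abs_cardinalBSpline_le q _)

lemma integral_cardinalBSpline_mul_add (r q : ℕ) (w z : ℝ) :
    ∫ y, cardinalBSpline r (y + w) * cardinalBSpline q (y + z)
      = cardinalBSpline (r + q + 1) (r + 1 + (z - w)) := by
  rw [← integral_cardinalBSpline_mul, ← integral_add_right_eq_self
    (fun y => cardinalBSpline r y * cardinalBSpline q (y + (z - w))) w]
  congr 1; funext y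
  rw [show y + w + (z - w) = y + z by ring]

lemma ae_deriv_cardinalBSpline (r : ℕ) (z : ℝ) :
    ∀ᵐ y : ℝ, deriv (cardinalBSpline (r + 1)) (y + z)
      = cardinalBSpline r (y + z) - cardinalBSpline r (y + (z - 1)) := by
  have h : ∀ᵐ y : ℝ, y + z ∉ Set.range ((↑) : ℤ → ℝ) :=
    (measurePreserving_add_right volume z).quasiMeasurePreserving.ae ae_notMem_range_intCast
  filter_upwards [h] with y hy
  rw [(hasDerivAt_cardinalBSpline_of_notMem r hy).deriv, add_sub_assoc]

/-- Almost everywhere `φ_p'` is a difference of shifts of `φ_{p-1}`, also for `p = 1`, where `φ_p` is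
not differentiable at the knots. -/
lemma integral_cardinalBSpline_mul_deriv {p : ℕ} (hp : 1 ≤ p) (z : ℝ) :
    ∫ y, cardinalBSpline p y * deriv (cardinalBSpline p) (y + z)
      = deriv (cardinalBSpline (2 * p + 1)) (p + 1 + z) := by
  obtain ⟨r, rfl⟩ : ∃ r, p = r + 1 := ⟨p - 1, by omega⟩
  have e : (fun y => cardinalBSpline (r + 1) y * deriv (cardinalBSpline (r + 1)) (y + z))
      =ᵐ[volume] fun y => cardinalBSpline (r + 1) (y + 0) * cardinalBSpline r (y + z)
        - cardinalBSpline (r + 1) (y + 0) * cardinalBSpline r (y + (z - 1)) := by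
    filter_upwards [ae_deriv_cardinalBSpline r z] with y hy
    rw [hy, add_zero]; ring
  rw [integral_congr_ae e, integral_sub (integrable_cardinalBSpline_mul _ _ _ _)
    (integrable_cardinalBSpline_mul _ _ _ _), integral_cardinalBSpline_mul_add,
    integral_cardinalBSpline_mul_add, show 2 * (r + 1) + 1 = (2 * r + 1) + 2 by ring,
    deriv_cardinalBSpline, show r + 1 + r + 1 = 2 * r + 1 + 1 by ring]
  dsimp only
  congr 2 <;> ring

lemma integral_deriv_cardinalBSpline_mul_deriv {p : ℕ} (hp : 1 ≤ p) (z : ℝ) :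
    ∫ y, deriv (cardinalBSpline p) y * deriv (cardinalBSpline p) (y + z)
      = -iteratedDeriv 2 (cardinalBSpline (2 * p + 1)) (p + 1 + z) := by
  obtain ⟨r, rfl⟩ : ∃ r, p = r + 1 := ⟨p - 1, by omega⟩
  have e : (fun y => deriv (cardinalBSpline (r + 1)) y * deriv (cardinalBSpline (r + 1)) (y + z))
      =ᵐ[volume] fun y => (cardinalBSpline r (y + 0) * cardinalBSpline r (y + z)
        - cardinalBSpline r (y + 0) * cardinalBSpline r (y + (z - 1)))
        - (cardinalBSpline r (y + (0 - 1)) * cardinalBSpline r (y + z)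
        - cardinalBSpline r (y + (0 - 1)) * cardinalBSpline r (y + (z - 1))) := by
    filter_upwards [ae_deriv_cardinalBSpline r z, ae_deriv_cardinalBSpline r 0] with y hy hy0
    rw [add_zero] at hy0
    rw [hy0, hy, add_zero]; ring
  have hi := integrable_cardinalBSpline_mul r r
  have hi' : ∀ w, Integrable fun y => cardinalBSpline r (y + w) * cardinalBSpline r (y + z)
      - cardinalBSpline r (y + w) * cardinalBSpline r (y + (z - 1)) :=
    fun w => (hi _ _).sub (hi _ _)
  rw [integral_congr_ae e, integral_sub (hi' _) (hi' _),
    integral_sub (hi _ _) (hi _ _), integral_sub (hi _ _) (hi _ _)]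
  simp only [integral_cardinalBSpline_mul_add]
  rw [show 2 * (r + 1) + 1 = 2 * r + 3 by ring, iteratedDeriv_two_cardinalBSpline,
    show r + r + 1 = 2 * r + 1 by ring]
  push_cast
  rw [show (r : ℝ) + 1 + (z - 0) = r + 1 + 1 + z - 1 by ring,
    show (r : ℝ) + 1 + (z - 1 - 0) = r + 1 + 1 + z - 2 by ring,
    show (r : ℝ) + 1 + (z - (0 - 1)) = r + 1 + 1 + z by ring,
    show (r : ℝ) + 1 + (z - 1 - (0 - 1)) = r + 1 + 1 + z - 1 by ring]
  ring

/-! ### Symmetries of the Fourier coefficients of the symbols -/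

lemma cardinalBSpline_mid_symm (p : ℕ) (t : ℝ) :
    cardinalBSpline (2 * p + 1) (p + 1 - t) = cardinalBSpline (2 * p + 1) (p + 1 + t) := by
  rw [← cardinalBSpline_symm]; congr 1; push_cast; ring

lemma deriv_cardinalBSpline_mid_symm (p : ℕ) (t : ℝ) :
    deriv (cardinalBSpline (2 * p + 1)) (p + 1 - t)
      = -deriv (cardinalBSpline (2 * p + 1)) (p + 1 + t) := by
  have h : cardinalBSpline (2 * p + 1)
      = fun s => cardinalBSpline (2 * p + 1) ((2 * p : ℕ) + 2 - s) :=
    funext fun s => (cardinalBSpline_symm _ s).symm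
  conv_lhs => rw [h]
  rw [deriv_comp_const_sub]
  congr 2; push_cast; ring

lemma iteratedDeriv_two_cardinalBSpline_mid_symm {p : ℕ} (hp : 1 ≤ p) (t : ℝ) :
    iteratedDeriv 2 (cardinalBSpline (2 * p + 1)) (p + 1 - t)
      = iteratedDeriv 2 (cardinalBSpline (2 * p + 1)) (p + 1 + t) := by
  obtain ⟨r, rfl⟩ : ∃ r, p = r + 1 := ⟨p - 1, by omega⟩
  rw [show 2 * (r + 1) + 1 = 2 * r + 3 by ring, iteratedDeriv_two_cardinalBSpline,
    iteratedDeriv_two_cardinalBSpline]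
  have h := fun s => cardinalBSpline_symm (2 * r) s
  push_cast at h ⊢
  rw [← h ((r : ℝ) + 1 + 1 - t), ← h ((r : ℝ) + 1 + 1 - t - 1), ← h ((r : ℝ) + 1 + 1 - t - 2),
    show 2 * (r : ℝ) + 2 - (r + 1 + 1 - t) = r + 1 + 1 + t - 2 by ring,
    show 2 * (r : ℝ) + 2 - (r + 1 + 1 - t - 1) = r + 1 + 1 + t - 1 by ring,
    show 2 * (r : ℝ) + 2 - (r + 1 + 1 - t - 2) = r + 1 + 1 + t by ring]
  ring

/-! ### B-splines on the unit interval: supports and bounds -/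

lemma knot_eq {n : ℕ} (hn : 1 ≤ n) (p i : ℕ) :
    knot p n i = ((min (i - (p + 1)) n : ℕ) : ℝ) / n := by
  have hn' : (n : ℝ) ≠ 0 := by positivity
  unfold knot
  split_ifs with h1 h2
  · rw [Nat.sub_eq_zero_of_le h1]; simp
  · rw [min_eq_left (by omega), Nat.cast_sub (by omega)]; push_cast; ring
  · rw [min_eq_right (by omega), div_self hn']

lemma knot_mono {n : ℕ} (hn : 1 ≤ n) (p : ℕ) : Monotone (knot p n) := by
  intro i j h
  rw [knot_eq hn, knot_eq hn]
  have : min (i - (p + 1)) n ≤ min (j - (p + 1)) n := by omega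
  gcongr

lemma knot_add_sub_le {n : ℕ} (hn : 1 ≤ n) (p i k : ℕ) :
    knot p n (i + k) - knot p n i ≤ k / n := by
  rw [knot_eq hn, knot_eq hn, ← sub_div]
  have : min (i + k - (p + 1)) n ≤ k + min (i - (p + 1)) n := by omega
  have h : ((min (i + k - (p + 1)) n : ℕ) : ℝ) ≤ k + (min (i - (p + 1)) n : ℕ) := by
    exact_mod_cast this
  gcongr
  linarith

/-- Distinct knots are at distance at least `1 / n`; coinciding knots are covered by `0⁻¹ = 0`. -/
lemma abs_one_div_knot_sub_le {n : ℕ} (hn : 1 ≤ n) (p i j : ℕ) (hij : i ≤ j) :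
    |1 / (knot p n j - knot p n i)| ≤ n := by
  have hn' : (0 : ℝ) < n := by positivity
  rw [knot_eq hn, knot_eq hn, ← sub_div]
  have h : min (i - (p + 1)) n ≤ min (j - (p + 1)) n := by omega
  rw [← Nat.cast_sub h, one_div_div, abs_of_nonneg (by positivity)]
  rcases Nat.eq_zero_or_pos (min (j - (p + 1)) n - min (i - (p + 1)) n) with h0 | h0
  · rw [h0]; simp
  · have : (1 : ℝ) ≤ ((min (j - (p + 1)) n - min (i - (p + 1)) n : ℕ) : ℝ) := by exact_mod_cast h0
    exact div_le_self hn'.le this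

/-- The grid `{j / n}`; it contains all knots. -/
def grid (n : ℕ) : Set ℝ := Set.range fun j : ℕ => (j : ℝ) / n

lemma knot_mem_grid {n : ℕ} (hn : 1 ≤ n) (p i : ℕ) : knot p n i ∈ grid n :=
  ⟨_, (knot_eq hn p i).symm⟩

lemma ae_notMem_grid (n : ℕ) : ∀ᵐ x : ℝ, x ∉ grid n := (Set.countable_range _).ae_notMem _

lemma bsplineAux_ne_zero {n : ℕ} (hn : 1 ≤ n) {p k i : ℕ} {x : ℝ} (h : bsplineAux p n k i x ≠ 0) :
    knot p n i ≤ x ∧ x < knot p n (i + k + 1) := by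
  induction k generalizing i with
  | zero =>
    rw [bsplineAux] at h
    by_contra h'
    exact h (if_neg h')
  | succ k ih =>
    rw [bsplineAux] at h
    by_cases h1 : bsplineAux p n k i x = 0
    · have h2 : bsplineAux p n k (i + 1) x ≠ 0 := by
        rintro h2; simp [h1, h2] at h
      have := ih h2
      rw [show i + (k + 1) + 1 = i + 1 + k + 1 by ring]
      exact ⟨(knot_mono hn p (by omega)).trans this.1, this.2⟩
    · have := ih h1
      exact ⟨this.1, this.2.trans_le (knot_mono hn p (by omega))⟩

lemma deriv_bsplineAux_ne_zero {n : ℕ} (hn : 1 ≤ n) {p k i : ℕ} {x : ℝ}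
    (h : deriv (bsplineAux p n k i) x ≠ 0) : knot p n i ≤ x ∧ x ≤ knot p n (i + k + 1) := by
  have hx : x ∈ tsupport (bsplineAux p n k i) := by
    by_contra hx
    have : bsplineAux p n k i =ᶠ[𝓝 x] fun _ => 0 := notMem_tsupport_iff_eventuallyEq.1 hx
    exact h (by rw [this.deriv_eq, deriv_const])
  have : tsupport (bsplineAux p n k i) ⊆ Set.Icc (knot p n i) (knot p n (i + k + 1)) :=
    closure_minimal (fun y hy => ⟨(bsplineAux_ne_zero hn hy).1, (bsplineAux_ne_zero hn hy).2.le⟩)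
      isClosed_Icc
  exact this hx

lemma abs_sub_div_sub_le_one {a b x : ℝ} (ha : a ≤ x) (hb : x ≤ b) : |(x - a) / (b - a)| ≤ 1 := by
  rw [abs_of_nonneg (div_nonneg (by linarith) (by linarith))]
  exact div_le_one_of_le₀ (by linarith) (by linarith)

lemma abs_sub_div_sub_le_one' {a b x : ℝ} (ha : a ≤ x) (hb : x ≤ b) : |(b - x) / (b - a)| ≤ 1 := by
  rw [abs_of_nonneg (div_nonneg (by linarith) (by linarith))]
  exact div_le_one_of_le₀ (by linarith) (by linarith)

lemma abs_mul_le_of_ne_zero {c u B : ℝ} (hB : |u| ≤ B) (hc : u ≠ 0 → |c| ≤ 1) : |c * u| ≤ B := by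
  by_cases hu : u = 0
  · simpa [hu] using (abs_nonneg u).trans hB
  · rw [abs_mul]
    exact (mul_le_of_le_one_left (abs_nonneg u) (hc hu)).trans hB

/-- A crude bound, independent of the mesh: on the support of each of the two lower-degree B-splines
the affine weight of the recursion lies in `[0, 1]`. -/
lemma abs_bsplineAux_le {n : ℕ} (hn : 1 ≤ n) (p k i : ℕ) (x : ℝ) :
    |bsplineAux p n k i x| ≤ 2 ^ k := by
  induction k generalizing i with
  | zero => rw [bsplineAux]; split_ifs <;> simp
  | succ k ih =>
    rw [bsplineAux, pow_succ, mul_two]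
    refine (abs_add_le _ _).trans (add_le_add (abs_mul_le_of_ne_zero (ih i) fun h => ?_)
      (abs_mul_le_of_ne_zero (ih (i + 1)) fun h => ?_))
    · have := bsplineAux_ne_zero hn h
      exact abs_sub_div_sub_le_one this.1 this.2.le
    · have := bsplineAux_ne_zero hn h
      rw [show i + (k + 1) + 1 = i + 1 + k + 1 by ring]
      exact abs_sub_div_sub_le_one' this.1 this.2.le

/-- Away from the grid the B-splines are smooth, with derivative of order `n`. -/
lemma differentiableAt_bsplineAux {n : ℕ} (hn : 1 ≤ n) (p k i : ℕ) {x : ℝ} (hx : x ∉ grid n) :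
    DifferentiableAt ℝ (bsplineAux p n k i) x ∧
      |deriv (bsplineAux p n k i) x| ≤ k * 2 ^ k * n := by
  induction k generalizing i with
  | zero =>
    have : ∃ c : ℝ, bsplineAux p n 0 i =ᶠ[𝓝 x] fun _ => c := by
      have n0 : x ≠ knot p n i := fun h => hx (h ▸ knot_mem_grid hn p i)
      have n1 : x ≠ knot p n (i + 1) := fun h => hx (h ▸ knot_mem_grid hn p (i + 1))
      rcases lt_or_gt_of_ne n0 with h | h
      · exact ⟨0, (eventually_lt_nhds h).mono fun y hy => if_neg fun h' => by linarith [h'.1]⟩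
      rcases lt_or_gt_of_ne n1 with h' | h'
      · refine ⟨1, ?_⟩
        filter_upwards [eventually_lt_nhds h', eventually_gt_nhds h] with y hy hy'
        exact if_pos ⟨hy'.le, hy⟩
      · exact ⟨0, (eventually_gt_nhds h').mono fun y hy => if_neg fun h' => by linarith [h'.2]⟩
    obtain ⟨c, hc⟩ := this
    have hd := (hasDerivAt_const x c).congr_of_eventuallyEq hc
    exact ⟨hd.differentiableAt, by rw [hd.deriv]; simp⟩
  | succ k ih =>
    have e₁ : HasDerivAt (fun s : ℝ => (s - knot p n i) / (knot p n (i + (k + 1)) - knot p n i))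
        (1 / (knot p n (i + (k + 1)) - knot p n i)) x :=
      ((hasDerivAt_id x).sub_const _).div_const _
    have e₂ : HasDerivAt (fun s : ℝ => (knot p n (i + (k + 1) + 1) - s) /
        (knot p n (i + (k + 1) + 1) - knot p n (i + 1)))
        ((-1) / (knot p n (i + (k + 1) + 1) - knot p n (i + 1))) x :=
      ((hasDerivAt_id x).const_sub _).div_const _
    have h := (e₁.mul (ih i).1.hasDerivAt).add (e₂.mul (ih (i + 1)).1.hasDerivAt)
    have h' : HasDerivAt (bsplineAux p n (k + 1) i) _ x := h
    refine ⟨h'.differentiableAt, ?_⟩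
    rw [h'.deriv]
    have b₁ : |1 / (knot p n (i + (k + 1)) - knot p n i) * bsplineAux p n k i x| ≤ n * 2 ^ k := by
      rw [abs_mul]
      exact mul_le_mul (abs_one_div_knot_sub_le hn p _ _ (by omega)) (abs_bsplineAux_le hn p k i x)
        (abs_nonneg _) (Nat.cast_nonneg _)
    have b₂ : |(-1) / (knot p n (i + (k + 1) + 1) - knot p n (i + 1)) *
        bsplineAux p n k (i + 1) x| ≤ n * 2 ^ k := by
      rw [abs_mul, neg_div, abs_neg]
      exact mul_le_mul (abs_one_div_knot_sub_le hn p _ _ (by omega)) (abs_bsplineAux_le hn p k _ x)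
        (abs_nonneg _) (Nat.cast_nonneg _)
    have b₃ := abs_mul_le_of_ne_zero
      (c := (x - knot p n i) / (knot p n (i + (k + 1)) - knot p n i)) (ih i).2 fun h => by
        have := deriv_bsplineAux_ne_zero hn h
        exact abs_sub_div_sub_le_one this.1 this.2
    have b₄ := abs_mul_le_of_ne_zero (c := (knot p n (i + (k + 1) + 1) - x) /
        (knot p n (i + (k + 1) + 1) - knot p n (i + 1))) (ih (i + 1)).2 fun h => by
        have := deriv_bsplineAux_ne_zero hn h
        rw [show i + (k + 1) + 1 = i + 1 + k + 1 by ring]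
        exact abs_sub_div_sub_le_one' this.1 this.2
    have e : ((k + 1 : ℕ) : ℝ) * 2 ^ (k + 1) * n
        = n * 2 ^ k + k * 2 ^ k * n + (n * 2 ^ k + k * 2 ^ k * n) := by push_cast; ring
    rw [e]
    exact (abs_add_le _ _).trans (add_le_add ((abs_add_le _ _).trans (add_le_add b₁ b₃))
      ((abs_add_le _ _).trans (add_le_add b₂ b₄)))

/-- Away from the grid, the function `u` is bounded by `C` and vanishes outside `[a, b]`. -/
def IsBump (n : ℕ) (a b C : ℝ) (u : ℝ → ℝ) : Prop :=
  ∀ x, x ∉ grid n → |u x| ≤ C ∧ (u x ≠ 0 → a ≤ x ∧ x ≤ b)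

lemma isBump_bspline {n : ℕ} (hn : 1 ≤ n) (p i : ℕ) :
    IsBump n (knot p n i) (knot p n (i + p + 1)) (2 ^ p) (bspline p n i) := fun x _ =>
  ⟨abs_bsplineAux_le hn p p i x, fun h =>
    ⟨(bsplineAux_ne_zero hn h).1, (bsplineAux_ne_zero hn h).2.le⟩⟩

lemma isBump_deriv_bspline {n : ℕ} (hn : 1 ≤ n) (p i : ℕ) :
    IsBump n (knot p n i) (knot p n (i + p + 1)) (p * 2 ^ p * n) (deriv (bspline p n i)) :=
  fun _ hx => ⟨(differentiableAt_bsplineAux hn p p i hx).2, fun h => deriv_bsplineAux_ne_zero hn h⟩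

lemma IsBump.abs_integral_mul_le {n : ℕ} {a b C a' b' C' : ℝ} {u v : ℝ → ℝ}
    (hu : IsBump n a b C u) (hv : IsBump n a' b' C' v) (hab : a ≤ b) (hC : 0 ≤ C) (hC' : 0 ≤ C') :
    |∫ x in (0 : ℝ)..1, u x * v x| ≤ C * C' * (b - a) := by
  have hg : Integrable (Set.indicator (Set.Icc a b) fun _ => C * C') :=
    (integrable_indicator_iff measurableSet_Icc).2 continuousOn_const.integrableOn_Icc
  have hle : ∀ᵐ x : ℝ, ‖u x * v x‖ ≤ Set.indicator (Set.Icc a b) (fun _ => C * C') x := by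
    filter_upwards [ae_notMem_grid n] with x hx
    by_cases hux : u x = 0
    · rw [hux, zero_mul, norm_zero]
      exact Set.indicator_nonneg (fun _ _ => mul_nonneg hC hC') _
    · rw [Set.indicator_of_mem (show x ∈ Set.Icc a b from (hu x hx).2 hux), Real.norm_eq_abs,
        abs_mul]
      exact mul_le_mul (hu x hx).1 (hv x hx).1 (abs_nonneg _) hC
  rw [intervalIntegral.integral_of_le zero_le_one, ← Real.norm_eq_abs]
  calc _ ≤ ∫ x in Set.Ioc (0 : ℝ) 1, Set.indicator (Set.Icc a b) (fun _ => C * C') x :=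
        norm_integral_le_of_norm_le hg.integrableOn (ae_restrict_of_ae hle)
    _ ≤ ∫ x, Set.indicator (Set.Icc a b) (fun _ => C * C') x :=
        setIntegral_le_integral hg (ae_of_all _ (Set.indicator_nonneg fun _ _ => mul_nonneg hC hC'))
    _ = C * C' * (b - a) := by
        rw [integral_indicator measurableSet_Icc, setIntegral_const, Real.volume_real_Icc_of_le hab,
          smul_eq_mul, mul_comm]

lemma IsBump.integral_mul_eq_zero {n : ℕ} {a b C a' b' C' : ℝ} {u v : ℝ → ℝ}
    (hu : IsBump n a b C u) (hv : IsBump n a' b' C' v) (h : b ≤ a') (ha' : a' ∈ grid n) :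
    ∫ x in (0 : ℝ)..1, u x * v x = 0 := by
  refine intervalIntegral.integral_zero_ae ?_
  -- the supports meet at most in `a'`, which is a grid point
  filter_upwards [ae_notMem_grid n] with x hx _
  by_contra h0
  rw [mul_eq_zero, not_or] at h0
  have h1 := (hu x hx).2 h0.1
  have h2 := (hv x hx).2 h0.2
  exact hx ((le_antisymm h2.1 (h1.2.trans h)) ▸ ha')

/-! ### Interior B-splines are scaled cardinal B-splines -/

lemma bsplineAux_eq_cardinalBSpline {n : ℕ} (hn : 1 ≤ n) {p k i : ℕ} (hi : p + 1 ≤ i)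
    (hik : i + k ≤ n + p) (x : ℝ) :
    bsplineAux p n k i x = cardinalBSpline k (n * x - ((i : ℝ) - (p + 1))) := by
  have hn' : (0 : ℝ) < n := by positivity
  have hk : ∀ j, p + 1 ≤ j → j ≤ n + p + 1 → knot p n j = ((j : ℝ) - (p + 1)) / n := by
    intro j h1 h2
    rw [knot_eq hn, min_eq_left (by omega), Nat.cast_sub h1]; push_cast; rfl
  induction k generalizing i with
  | zero =>
    rw [bsplineAux, cardinalBSpline, hk i hi (by omega), hk (i + 1) (by omega) (by omega)]
    congr 1
    rw [div_le_iff₀ hn', lt_div_iff₀ hn']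
    push_cast
    apply propext
    constructor <;> rintro ⟨h1, h2⟩ <;> constructor <;> linarith
  | succ k ih =>
    rw [bsplineAux, cardinalBSpline_succ, ih hi (by omega), ih (by omega : p + 1 ≤ i + 1) (by omega),
      hk i hi (by omega), hk (i + (k + 1)) (by omega) (by omega),
      hk (i + (k + 1) + 1) (by omega) (by omega), hk (i + 1) (by omega) (by omega)]
    have hk1 : (k : ℝ) + 1 ≠ 0 := by positivity
    have a1 : n * x - (((i + 1 : ℕ) : ℝ) - (p + 1)) = n * x - ((i : ℝ) - (p + 1)) - 1 := by
      push_cast; ring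
    rw [a1, ← sub_div, ← sub_div]
    push_cast
    rw [show (i : ℝ) + (k + 1) - (p + 1) - (i - (p + 1)) = k + 1 by ring,
      show (i : ℝ) + (k + 1) + 1 - (p + 1) - (i + 1 - (p + 1)) = k + 1 by ring]
    congr 2
    · field_simp
    · field_simp
      ring

lemma bspline_eq_cardinalBSpline {n p i : ℕ} (hi : p + 1 ≤ i) (hin : i ≤ n) :
    bspline p n i = fun x => cardinalBSpline p (n * x - ((i : ℝ) - (p + 1))) :=
  funext fun x => bsplineAux_eq_cardinalBSpline (by omega) hi (by omega) x

lemma deriv_bspline_eq {n p i : ℕ} (hi : p + 1 ≤ i) (hin : i ≤ n) :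
    deriv (bspline p n i)
      = fun x => n * deriv (cardinalBSpline p) (n * x - ((i : ℝ) - (p + 1))) := by
  funext x
  rw [bspline_eq_cardinalBSpline hi hin, deriv_comp_mul_left (n : ℝ)
    (fun y => cardinalBSpline p (y - ((i : ℝ) - (p + 1)))) x, smul_eq_mul, deriv_comp_sub_const]

/-- Change of variables for products of functions that live on the support of interior B-splines. -/
lemma integral_comp_mul_sub {n p i : ℕ} (hi : p + 1 ≤ i) (hin : i ≤ n) {a b C : ℝ}
    {u f g : ℝ → ℝ} (c : ℝ) (hu : IsBump n (knot p n i) (knot p n (i + p + 1)) C u)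
    (huf : ∀ x, u x = a * f (n * x - ((i : ℝ) - (p + 1)))) :
    ∫ x in (0 : ℝ)..1, u x * (b * g (n * x - (c - (p + 1))))
      = a * b / n * ∫ y, f y * g (y + (i - c)) := by
  have hn : 1 ≤ n := by omega
  have hn' : (0 : ℝ) < n := by positivity
  rw [intervalIntegral.integral_of_le zero_le_one, ← integral_Icc_eq_integral_Ioc,
    setIntegral_eq_integral_of_ae_compl_eq_zero]
  · simp_rw [huf]
    have := Measure.integral_comp_mul_left
      (fun y => a * b * (f (y - ((i : ℝ) - (p + 1))) * g (y - (c - (p + 1))))) (n : ℝ)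
    rw [abs_of_pos (inv_pos.2 hn'), smul_eq_mul] at this
    rw [← integral_sub_right_eq_self (fun y => f y * g (y + (i - c))) ((i : ℝ) - (p + 1))]
    calc _ = ∫ x, a * b * (f (n * x - ((i : ℝ) - (p + 1))) * g (n * x - (c - (p + 1)))) := by
          congr 1; funext x; ring
      _ = _ := by
        rw [this, integral_const_mul]
        have : ∀ y, y - ((i : ℝ) - (p + 1)) + (i - c) = y - (c - (p + 1)) := fun y => by ring
        simp_rw [this]
        ring
  · filter_upwards [ae_notMem_grid n] with x hx hx'
    by_contra h
    have := (hu x hx).2 (left_ne_zero_of_mul h)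
    refine hx' ⟨le_trans ?_ this.1, this.2.trans ?_⟩
    · rw [knot_eq hn]; positivity
    · rw [knot_eq hn]
      apply div_le_one_of_le₀ _ hn'.le
      exact_mod_cast min_le_right _ _

/-! ### Banded matrices that are Toeplitz in the interior -/

/-- The matrix `B` has bandwidth `p`, entries bounded by `C`, and the entry in position `(i, j)`
is `g (i - j)` as soon as `i` and `j` both belong to interior B-splines, whose supports lie in
the uniform part of the knot sequence. -/
structure IsBandedToeplitz (p n : ℕ) (C : ℝ) (g : ℤ → ℝ)
    (B : Matrix (Fin (n + p - 2)) (Fin (n + p - 2)) ℝ) : Prop where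
  abs_apply_le : ∀ i j, |B i j| ≤ C
  apply_eq_zero : ∀ i j : Fin (n + p - 2), (p : ℤ) < |((i : ℕ) : ℤ) - (j : ℕ)| → B i j = 0
  apply_eq : ∀ i j : Fin (n + p - 2), p ≤ (i : ℕ) + 1 → (i : ℕ) + 2 ≤ n → p ≤ (j : ℕ) + 1 →
    (j : ℕ) + 2 ≤ n → B i j = g (((i : ℕ) : ℤ) - (j : ℕ))

lemma IsBandedToeplitz.transpose {p n : ℕ} {C : ℝ} {g : ℤ → ℝ}
    {B : Matrix (Fin (n + p - 2)) (Fin (n + p - 2)) ℝ} (h : IsBandedToeplitz p n C g B) :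
    IsBandedToeplitz p n C (fun k => g (-k)) B.transpose where
  abs_apply_le i j := h.abs_apply_le j i
  apply_eq_zero i j hij := h.apply_eq_zero j i (by rwa [abs_sub_comm])
  apply_eq i j h1 h2 h3 h4 := by
    rw [Matrix.transpose_apply, h.apply_eq j i h3 h4 h1 h2, neg_sub]

/-- A Gram-type matrix of integrals `∫ u_i v_j`, where `u_i` and `v_j` live on the supports of the
B-splines and, in the interior, are scaled translates of `f` and `g`. -/
lemma isBandedToeplitz_of_isBump {p n : ℕ} (hn : 1 ≤ n) {s a b Cu Cv C : ℝ} {u v : ℕ → ℝ → ℝ}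
    {f g : ℝ → ℝ} (hs : 0 ≤ s) (hCu : 0 ≤ Cu) (hCv : 0 ≤ Cv)
    (hu : ∀ i, IsBump n (knot p n i) (knot p n (i + p + 1)) Cu (u i))
    (hv : ∀ i, IsBump n (knot p n i) (knot p n (i + p + 1)) Cv (v i))
    (huf : ∀ i, p + 1 ≤ i → i ≤ n → ∀ x, u i x = a * f (n * x - ((i : ℝ) - (p + 1))))
    (hvg : ∀ i, p + 1 ≤ i → i ≤ n → ∀ x, v i x = b * g (n * x - ((i : ℝ) - (p + 1))))
    (hC : s * Cu * Cv * (p + 1) ≤ C * n) (hab : s * a * b = n)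
    {B : Matrix (Fin (n + p - 2)) (Fin (n + p - 2)) ℝ}
    (hB : ∀ i j, B i j = s * ∫ x in (0 : ℝ)..1, u (i + 2) x * v (j + 2) x) :
    IsBandedToeplitz p n C (fun k => ∫ y, f y * g (y + k)) B where
  abs_apply_le i j := by
    have hn' : (0 : ℝ) < n := by positivity
    rw [hB, abs_mul, abs_of_nonneg hs]
    have h1 := (hu (i + 2)).abs_integral_mul_le (hv (j + 2)) (knot_mono hn p (by omega)) hCu hCv
    have h2 := knot_add_sub_le hn p (i + 2) (p + 1)
    push_cast at h2
    calc _ ≤ s * (Cu * Cv * ((p + 1) / n)) := by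
          refine mul_le_mul_of_nonneg_left (h1.trans ?_) hs
          exact mul_le_mul_of_nonneg_left h2 (mul_nonneg hCu hCv)
      _ = s * Cu * Cv * (p + 1) / n := by ring
      _ ≤ C := by rwa [div_le_iff₀ hn']
  apply_eq_zero i j hij := by
    rw [hB]
    rcases lt_abs.1 hij with h | h
    · simp_rw [mul_comm (u _ _)]
      rw [(hv (j + 2)).integral_mul_eq_zero (hu (i + 2)) (knot_mono hn p (by omega))
        (knot_mem_grid hn p _), mul_zero]
    · rw [(hu (i + 2)).integral_mul_eq_zero (hv (j + 2)) (knot_mono hn p (by omega))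
        (knot_mem_grid hn p _), mul_zero]
  apply_eq i j h1 h2 h3 h4 := by
    have hn' : (n : ℝ) ≠ 0 := by positivity
    rw [hB]
    simp_rw [hvg (j + 2) (by omega) (by omega)]
    rw [integral_comp_mul_sub (by omega) h2 (((j : ℕ) + 2 : ℕ) : ℝ) (hu (i + 2))
      (huf _ (by omega) h2), ← mul_assoc, ← mul_div_assoc, ← mul_assoc, hab, div_self hn', one_mul]
    push_cast
    simp

/-- The bound `p² 4ᵖ (p + 1)` is chosen to serve the mass, advection and stiffness matrices alike. -/
lemma isBandedToeplitz_massMatrix {p n : ℕ} (hp : 1 ≤ p) (hn : 1 ≤ n) :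
    IsBandedToeplitz p n (p ^ 2 * 4 ^ p * (p + 1))
      (fun k => cardinalBSpline (2 * p + 1) (p + 1 + k)) ((n : ℝ) • massMatrix p n) := by
  have hn' : (n : ℝ) ≠ 0 := by positivity
  have hp' : (1 : ℝ) ≤ p := by exact_mod_cast hp
  have h := isBandedToeplitz_of_isBump (s := n) (a := 1) (b := 1) (C := p ^ 2 * 4 ^ p * (p + 1))
    (f := cardinalBSpline p) (g := cardinalBSpline p)
    hn (by positivity) (by positivity) (by positivity) (isBump_bspline hn p) (isBump_bspline hn p)
    (fun i h1 h2 x => by rw [bspline_eq_cardinalBSpline h1 h2, one_mul])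
    (fun i h1 h2 x => by rw [bspline_eq_cardinalBSpline h1 h2, one_mul])
    (by
      rw [show (4 : ℝ) ^ p = 2 ^ p * 2 ^ p by rw [← mul_pow]; norm_num]
      have : (1 : ℝ) ≤ p ^ 2 := one_le_pow₀ hp'
      nlinarith [mul_nonneg (sub_nonneg.2 this)
        (by positivity : (0 : ℝ) ≤ 2 ^ p * 2 ^ p * (p + 1) * n)])
    (by ring) (B := (n : ℝ) • massMatrix p n) (fun i j => rfl)
  convert h using 2 with k
  rw [integral_cardinalBSpline_mul, two_mul]

lemma isBandedToeplitz_advectionMatrix {p n : ℕ} (hp : 1 ≤ p) (hn : 1 ≤ n) :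
    IsBandedToeplitz p n (p ^ 2 * 4 ^ p * (p + 1))
      (fun k => deriv (cardinalBSpline (2 * p + 1)) (p + 1 + k)) (advectionMatrix p n) := by
  have hn' : (n : ℝ) ≠ 0 := by positivity
  have hp' : (1 : ℝ) ≤ p := by exact_mod_cast hp
  have h := isBandedToeplitz_of_isBump (s := 1) (a := 1) (b := n) (C := p ^ 2 * 4 ^ p * (p + 1))
    (f := cardinalBSpline p) (g := deriv (cardinalBSpline p))
    hn (by positivity) (by positivity) (by positivity) (isBump_bspline hn p)
    (isBump_deriv_bspline hn p)
    (fun i h1 h2 x => by rw [bspline_eq_cardinalBSpline h1 h2, one_mul])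
    (fun i h1 h2 x => by rw [deriv_bspline_eq h1 h2])
    (by
      rw [show (4 : ℝ) ^ p = 2 ^ p * 2 ^ p by rw [← mul_pow]; norm_num]
      nlinarith [mul_nonneg (sub_nonneg.2 hp')
        (by positivity : (0 : ℝ) ≤ p * (2 ^ p * 2 ^ p * (p + 1) * n))])
    (by ring) (B := advectionMatrix p n) (fun i j => (one_mul _).symm)
  convert h using 2 with k
  rw [integral_cardinalBSpline_mul_deriv hp]

lemma isBandedToeplitz_stiffnessMatrix {p n : ℕ} (hp : 1 ≤ p) (hn : 1 ≤ n) :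
    IsBandedToeplitz p n (p ^ 2 * 4 ^ p * (p + 1))
      (fun k => -iteratedDeriv 2 (cardinalBSpline (2 * p + 1)) (p + 1 + k))
      ((n : ℝ)⁻¹ • stiffnessMatrix p n) := by
  have hn' : (n : ℝ) ≠ 0 := by positivity
  have h := isBandedToeplitz_of_isBump (s := (n : ℝ)⁻¹) (a := n) (b := n)
    (C := p ^ 2 * 4 ^ p * (p + 1))
    (f := deriv (cardinalBSpline p)) (g := deriv (cardinalBSpline p))
    hn (by positivity) (by positivity) (by positivity) (isBump_deriv_bspline hn p)
    (isBump_deriv_bspline hn p)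
    (fun i h1 h2 x => by rw [deriv_bspline_eq h1 h2])
    (fun i h1 h2 x => by rw [deriv_bspline_eq h1 h2])
    (by
      rw [show (4 : ℝ) ^ p = 2 ^ p * 2 ^ p by rw [← mul_pow]; norm_num]
      apply le_of_eq
      field_simp)
    (by field_simp) (B := (n : ℝ)⁻¹ • stiffnessMatrix p n) (fun i j => rfl)
  convert h using 2 with k
  rw [integral_deriv_cardinalBSpline_mul_deriv hp]

/-! ### Symbols as trigonometric polynomials -/

lemma sum_Icc_neg_eq {M : Type*} [AddCommMonoid M] (h : ℤ → M) (p : ℕ) :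
    ∑ k ∈ Finset.Icc (-(p : ℤ)) p, h k = h 0 + ∑ k ∈ Finset.Icc 1 p, (h k + h (-k)) := by
  induction p with
  | zero => simp
  | succ p ih =>
    have e : Finset.Icc (-((p + 1 : ℕ) : ℤ)) ((p + 1 : ℕ) : ℤ)
        = insert ((p : ℤ) + 1) (insert (-((p : ℤ) + 1)) (Finset.Icc (-(p : ℤ)) p)) := by
      ext x; simp only [Finset.mem_Icc, Finset.mem_insert]; push_cast; omega
    rw [e, Finset.sum_insert, Finset.sum_insert, ih, Finset.sum_Icc_succ_top (by omega)]
    · push_cast; abel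
    · simp
    · simp only [Finset.mem_Icc, Finset.mem_insert]; omega

lemma exp_add_exp_neg (k : ℕ) (θ : ℝ) :
    Complex.exp (((k : ℤ) : ℂ) * θ * Complex.I) + Complex.exp (((-(k : ℤ) : ℤ) : ℂ) * θ * Complex.I)
      = 2 * (Real.cos (k * θ) : ℝ) := by
  rw [Complex.ofReal_cos, Complex.two_cos]
  push_cast; ring_nf

lemma exp_sub_exp_neg (k : ℕ) (θ : ℝ) :
    Complex.exp (((k : ℤ) : ℂ) * θ * Complex.I) - Complex.exp (((-(k : ℤ) : ℤ) : ℂ) * θ * Complex.I)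
      = 2 * Complex.I * (Real.sin (k * θ) : ℝ) := by
  rw [Complex.ofReal_sin, mul_right_comm 2, Complex.two_sin, mul_assoc _ Complex.I,
    Complex.I_mul_I]
  push_cast; ring_nf

lemma sum_even_eq (g : ℤ → ℝ) (hg : ∀ k, g (-k) = g k) (p : ℕ) (θ : ℝ) :
    ∑ k ∈ Finset.Icc (-(p : ℤ)) p, (g k : ℂ) * Complex.exp (k * θ * Complex.I)
      = ((g 0 + 2 * ∑ k ∈ Finset.Icc 1 p, g k * Real.cos (k * θ) : ℝ) : ℂ) := by
  rw [sum_Icc_neg_eq]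
  simp only [hg, ← mul_add, exp_add_exp_neg]
  push_cast
  rw [Finset.mul_sum]
  congr 1
  · simp
  · exact Finset.sum_congr rfl fun k _ => by ring

lemma sum_odd_eq (g : ℤ → ℝ) (hg : ∀ k, g (-k) = -g k) (p : ℕ) (θ : ℝ) :
    ∑ k ∈ Finset.Icc (-(p : ℤ)) p, (g k : ℂ) * Complex.exp (k * θ * Complex.I)
      = Complex.I * ((2 * ∑ k ∈ Finset.Icc 1 p, g k * Real.sin (k * θ) : ℝ) : ℂ) := by
  have h0 : g 0 = 0 := by have := hg 0; simp at this; linarith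
  rw [sum_Icc_neg_eq]
  simp only [hg, h0, Complex.ofReal_neg, neg_mul, ← sub_eq_add_neg, ← mul_sub, exp_sub_exp_neg]
  push_cast
  rw [Finset.mul_sum, Finset.mul_sum, zero_mul, zero_add]
  exact Finset.sum_congr rfl fun k _ => by ring

lemma sum_coeff_mass (p : ℕ) (θ : ℝ) :
    ∑ k ∈ Finset.Icc (-(p : ℤ)) p,
        ((cardinalBSpline (2 * p + 1) (p + 1 + k) : ℝ) : ℂ) * Complex.exp (k * θ * Complex.I)
      = (symbolM p θ : ℂ) := by
  rw [sum_even_eq (fun k => cardinalBSpline (2 * p + 1) (p + 1 + k))]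
  · simp only [symbolM, cardinalBSpline_mid_symm]; simp
  · intro k
    rw [← cardinalBSpline_mid_symm]; push_cast; ring_nf

lemma sum_coeff_stiffness {p : ℕ} (hp : 1 ≤ p) (θ : ℝ) :
    ∑ k ∈ Finset.Icc (-(p : ℤ)) p,
        ((-iteratedDeriv 2 (cardinalBSpline (2 * p + 1)) (p + 1 + k) : ℝ) : ℂ)
          * Complex.exp (k * θ * Complex.I)
      = (symbolS p θ : ℂ) := by
  rw [sum_even_eq (fun k => -iteratedDeriv 2 (cardinalBSpline (2 * p + 1)) (p + 1 + k))]
  · simp only [symbolS, iteratedDeriv_two_cardinalBSpline_mid_symm hp]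
    simp [sub_eq_add_neg]
  · intro k
    rw [← iteratedDeriv_two_cardinalBSpline_mid_symm hp]; push_cast; ring_nf

lemma sum_coeff_advection (p : ℕ) (θ : ℝ) :
    ∑ k ∈ Finset.Icc (-(p : ℤ)) p,
        ((deriv (cardinalBSpline (2 * p + 1)) (p + 1 + k) : ℝ) : ℂ)
          * Complex.exp (k * θ * Complex.I)
      = Complex.I * (symbolA p θ : ℂ) := by
  rw [sum_odd_eq (fun k => deriv (cardinalBSpline (2 * p + 1)) (p + 1 + k))]
  · simp only [symbolA, deriv_cardinalBSpline_mid_symm]; simp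
  · intro k
    rw [← deriv_cardinalBSpline_mid_symm]; push_cast; ring_nf

lemma sum_coeff_advection_neg (p : ℕ) (θ : ℝ) :
    ∑ k ∈ Finset.Icc (-(p : ℤ)) p,
        ((deriv (cardinalBSpline (2 * p + 1)) (p + 1 + ((-k : ℤ) : ℝ)) : ℝ) : ℂ)
          * Complex.exp (k * θ * Complex.I)
      = -(Complex.I * (symbolA p θ : ℂ)) := by
  rw [← sum_coeff_advection, ← Finset.sum_neg_distrib]
  refine Finset.sum_congr rfl fun k _ => ?_
  have := deriv_cardinalBSpline_mid_symm p k
  rw [Int.cast_neg, ← sub_eq_add_neg, this]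
  push_cast; ring

/-- Away from the boundary, the rows of a banded interior Toeplitz matrix act on exponentials as
multiplication by the generating trigonometric polynomial. -/
lemma IsBandedToeplitz.row_sum {p n : ℕ} {C : ℝ} {g : ℤ → ℝ} (hp : 1 ≤ p)
    {B : Matrix (Fin (n + p - 2)) (Fin (n + p - 2)) ℝ} (h : IsBandedToeplitz p n C g B)
    (i : Fin (n + p - 2)) (h1 : 2 * p ≤ i) (h2 : (i : ℕ) + 2 + p ≤ n) (θ : ℝ) :
    ∑ l, (B i l : ℂ) * Complex.exp (((((i : ℕ) : ℤ) - (l : ℕ) : ℤ) : ℂ) * θ * Complex.I)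
      = ∑ k ∈ Finset.Icc (-(p : ℤ)) p, (g k : ℂ) * Complex.exp (k * θ * Complex.I) := by
  classical
  rw [← Finset.sum_filter_add_sum_filter_not Finset.univ
    (fun l : Fin (n + p - 2) => |((i : ℕ) : ℤ) - (l : ℕ)| ≤ p)]
  rw [Finset.sum_eq_zero (s := Finset.univ.filter fun l : Fin (n + p - 2) =>
    ¬ |((i : ℕ) : ℤ) - (l : ℕ)| ≤ p), add_zero]
  · refine Finset.sum_bij (fun l _ => ((i : ℕ) : ℤ) - (l : ℕ)) ?_ ?_ ?_ ?_
    · intro l hl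
      simp only [Finset.mem_filter, Finset.mem_univ, true_and, abs_le] at hl
      exact Finset.mem_Icc.2 hl
    · intro l _ l' _ hll
      exact Fin.ext (by omega)
    · intro k hk
      rw [Finset.mem_Icc] at hk
      refine ⟨⟨((i : ℕ) - k).toNat, by omega⟩, ?_, ?_⟩
      · simp only [Finset.mem_filter, Finset.mem_univ, true_and, abs_le]
        omega
      · simp only; omega
    · intro l hl
      simp only [Finset.mem_filter, Finset.mem_univ, true_and, abs_le] at hl
      rw [h.apply_eq i l (by omega) (by omega) (by omega) (by omega)]
  · intro l hl
    simp only [Finset.mem_filter, Finset.mem_univ, true_and, not_le] at hl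
    rw [h.apply_eq_zero i l hl]; simp

/-! ### Matrices with bounded absolute row sums -/

section RowSums

variable {κ : Type*} [Fintype κ]

lemma row_sum_norm_mul_le {A B : Matrix κ κ ℂ} {R S : ℝ} (hA : ∀ x, ∑ y, ‖A x y‖ ≤ R)
    (hB : ∀ x, ∑ y, ‖B x y‖ ≤ S) (hS : 0 ≤ S) (x : κ) : ∑ y, ‖(A * B) x y‖ ≤ R * S := by
  calc ∑ y, ‖(A * B) x y‖ ≤ ∑ y, ∑ z, ‖A x z‖ * ‖B z y‖ := by
        refine Finset.sum_le_sum fun y _ => ?_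
        rw [Matrix.mul_apply]
        exact (norm_sum_le _ _).trans_eq (Finset.sum_congr rfl fun z _ => norm_mul _ _)
    _ = ∑ z, ‖A x z‖ * ∑ y, ‖B z y‖ := by
        rw [Finset.sum_comm]; simp_rw [Finset.mul_sum]
    _ ≤ ∑ z, ‖A x z‖ * S :=
        Finset.sum_le_sum fun z _ => mul_le_mul_of_nonneg_left (hB z) (norm_nonneg _)
    _ = (∑ z, ‖A x z‖) * S := by rw [Finset.sum_mul]
    _ ≤ R * S := mul_le_mul_of_nonneg_right (hA x) hS

variable [DecidableEq κ]

lemma row_sum_norm_pow_le {A : Matrix κ κ ℂ} {R : ℝ} (hR : 0 ≤ R) (hA : ∀ x, ∑ y, ‖A x y‖ ≤ R)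
    (k : ℕ) (x : κ) : ∑ y, ‖(A ^ k) x y‖ ≤ R ^ k := by
  induction k generalizing x with
  | zero =>
    simp only [pow_zero, Matrix.one_apply]
    simp [apply_ite]
  | succ k ih =>
    rw [pow_succ', pow_succ']
    exact row_sum_norm_mul_le hA ih (pow_nonneg hR k) x

lemma norm_pow_apply_le {A : Matrix κ κ ℂ} {R : ℝ} (hR : 0 ≤ R) (hA : ∀ x, ∑ y, ‖A x y‖ ≤ R)
    (k : ℕ) (x y : κ) : ‖(A ^ k) x y‖ ≤ R ^ k :=
  (Finset.single_le_sum (f := fun y => ‖(A ^ k) x y‖) (fun _ _ => norm_nonneg _)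
    (Finset.mem_univ y)).trans (row_sum_norm_pow_le hR hA k x)

/-- Gershgorin's theorem for Hermitian matrices. -/
lemma abs_eigenvalues_le {A : Matrix κ κ ℂ} {R : ℝ} (hA : A.IsHermitian)
    (h : ∀ x, ∑ y, ‖A x y‖ ≤ R) (j : κ) : |hA.eigenvalues j| ≤ R := by
  have hev : Module.End.HasEigenvalue (Matrix.toLin' A) ((hA.eigenvalues j : ℝ) : ℂ) := by
    refine Module.End.hasEigenvalue_of_hasEigenvector (x := ⇑(hA.eigenvectorBasis j)) ⟨?_, ?_⟩
    · rw [Module.End.mem_eigenspace_iff, Matrix.toLin'_apply, hA.mulVec_eigenvectorBasis]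
      rfl
    · intro h0
      refine hA.eigenvectorBasis.orthonormal.ne_zero j ?_
      ext x
      exact congrFun h0 x
  obtain ⟨x, hx⟩ := eigenvalue_mem_ball hev
  rw [mem_closedBall_iff_norm] at hx
  have h1 : ‖((hA.eigenvalues j : ℝ) : ℂ)‖ ≤ ‖A x x‖ + ∑ y ∈ Finset.univ.erase x, ‖A x y‖ := by
    have := norm_sub_norm_le ((hA.eigenvalues j : ℝ) : ℂ) (A x x)
    linarith
  rw [Finset.add_sum_erase _ (fun y => ‖A x y‖) (Finset.mem_univ x), Complex.norm_real] at h1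
  exact h1.trans (h x)

end RowSums

/-! ### Sums over eigenvalues -/

section EigenvalueSum

variable {κ : Type*} [Fintype κ] [DecidableEq κ]

/-- The sum of the values of `F` at the eigenvalues, counted with algebraic multiplicity. -/
def eigenvalueSum (A : Matrix κ κ ℂ) (F : ℂ → ℂ) : ℂ := (A.charpoly.roots.map F).sum

lemma eigenvalueSum_eq {A : Matrix κ κ ℂ} (hA : A.IsHermitian) (F : ℂ → ℂ) :
    eigenvalueSum A F = ∑ j, F (hA.eigenvalues j : ℝ) := by
  rw [eigenvalueSum, hA.roots_charpoly_eq_eigenvalues, Multiset.map_map]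
  rfl

lemma trace_pow_eq {A : Matrix κ κ ℂ} (hA : A.IsHermitian) (k : ℕ) :
    (A ^ k).trace = ∑ j, ((hA.eigenvalues j : ℝ) : ℂ) ^ k := by
  conv_lhs => rw [hA.spectral_theorem, ← map_pow, Matrix.diagonal_pow,
    Unitary.conjStarAlgAut_apply, Matrix.trace_mul_comm, ← mul_assoc]
  simp [Matrix.trace_diagonal]

lemma eigenvalueSum_eval {A : Matrix κ κ ℂ} (hA : A.IsHermitian) (P : Polynomial ℂ) :
    eigenvalueSum A (fun z => P.eval z)
      = ∑ k ∈ Finset.range (P.natDegree + 1), P.coeff k * (A ^ k).trace := by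
  simp_rw [eigenvalueSum_eq hA, trace_pow_eq hA, Polynomial.eval_eq_sum_range, Finset.mul_sum]
  exact Finset.sum_comm

lemma norm_eigenvalueSum_sub_le {A : Matrix κ κ ℂ} (hA : A.IsHermitian) {R ε : ℝ}
    (h : ∀ x, ∑ y, ‖A x y‖ ≤ R) {F G : ℂ → ℂ}
    (hFG : ∀ t : ℝ, |t| ≤ R → ‖F t - G t‖ ≤ ε) :
    ‖eigenvalueSum A F - eigenvalueSum A G‖ ≤ Fintype.card κ * ε := by
  rw [eigenvalueSum_eq hA, eigenvalueSum_eq hA, ← Finset.sum_sub_distrib]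
  refine (norm_sum_le _ _).trans ((Finset.sum_le_sum fun j _ =>
    hFG _ (abs_eigenvalues_le hA h j)).trans_eq ?_)
  simp

lemma norm_eigenvalueSum_div_sub_le {A : Matrix κ κ ℂ} (hA : A.IsHermitian) {R ε : ℝ}
    (h : ∀ x, ∑ y, ‖A x y‖ ≤ R) (hε : 0 ≤ ε) {F G : ℂ → ℂ}
    (hFG : ∀ t : ℝ, |t| ≤ R → ‖F t - G t‖ ≤ ε) {d : ℕ} (hd : Fintype.card κ = d) :
    ‖eigenvalueSum A F / (d : ℂ) - eigenvalueSum A G / (d : ℂ)‖ ≤ ε := by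
  rw [← sub_div, norm_div, Complex.norm_natCast]
  refine div_le_of_le_mul₀ (Nat.cast_nonneg _) hε ?_
  rw [mul_comm, ← hd]
  exact norm_eigenvalueSum_sub_le hA h hFG

lemma exists_polynomial_near {F : ℂ → ℂ} (hF : Continuous F) (R : ℝ) {ε : ℝ} (hε : 0 < ε) :
    ∃ P : Polynomial ℂ, ∀ t : ℝ, |t| ≤ R → ‖F t - P.eval (t : ℂ)‖ ≤ ε := by
  obtain ⟨p, hp⟩ := exists_polynomial_near_of_continuousOn (-R) R (fun t => (F t).re)
    (by fun_prop) (ε / 2) (by positivity)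
  obtain ⟨q, hq⟩ := exists_polynomial_near_of_continuousOn (-R) R (fun t => (F t).im)
    (by fun_prop) (ε / 2) (by positivity)
  refine ⟨p.map Complex.ofRealHom + Polynomial.C Complex.I * q.map Complex.ofRealHom,
    fun t ht => ?_⟩
  have e : ∀ r : Polynomial ℝ, (r.map Complex.ofRealHom).eval (t : ℂ) = (r.eval t : ℝ) :=
    fun r => Polynomial.eval_map_apply (f := Complex.ofRealHom) t
  have h1 := hp t (abs_le.1 ht)
  have h2 := hq t (abs_le.1 ht)
  rw [abs_sub_comm] at h1 h2
  refine (Complex.norm_le_abs_re_add_abs_im _).trans ?_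
  rw [Polynomial.eval_add, Polynomial.eval_mul, Polynomial.eval_C, e, e]
  simp only [Complex.sub_re, Complex.add_re, Complex.ofReal_re, Complex.mul_re, Complex.I_re,
    Complex.I_im, Complex.ofReal_im, Complex.sub_im, Complex.add_im, Complex.mul_im]
  simp only [zero_mul, mul_zero, one_mul, sub_zero, add_zero, zero_add]
  linarith

/-- For a continuous family of Hermitian matrices, sums over eigenvalues are continuous: they are
uniform limits of linear combinations of traces of powers. -/
lemma continuous_eigenvalueSum {T : Type*} [TopologicalSpace T] {f : T → Matrix κ κ ℂ}
    (hf : Continuous f) (hH : ∀ t, (f t).IsHermitian) {R : ℝ}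
    (hR : ∀ t x, ∑ y, ‖f t x y‖ ≤ R) {F : ℂ → ℂ} (hF : Continuous F) :
    Continuous fun t => eigenvalueSum (f t) F := by
  refine continuous_of_uniform_approx_of_continuous fun u hu => ?_
  obtain ⟨ε, hε, hεu⟩ := Metric.mem_uniformity_dist.1 hu
  have hd : (0 : ℝ) < Fintype.card κ + 1 := by positivity
  obtain ⟨P, hP⟩ := exists_polynomial_near hF R (div_pos hε hd)
  refine ⟨fun t => eigenvalueSum (f t) fun z => P.eval z, ?_, fun t => hεu ?_⟩
  · simp_rw [fun t => eigenvalueSum_eval (hH t) P]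
    fun_prop
  · rw [dist_eq_norm]
    refine (norm_eigenvalueSum_sub_le (hH t) (hR t) hP).trans_lt ?_
    rw [← mul_div_assoc, div_lt_iff₀ hd]
    nlinarith

/-- The method of moments: for uniformly bounded Hermitian matrices, convergence of the
normalized traces of all powers gives convergence of the normalized eigenvalue sums. -/
theorem tendsto_eigenvalueSum_of_moments {ι : Type*} {l : Filter ι} {κ : ι → Type*}
    [∀ i, Fintype (κ i)] [∀ i, DecidableEq (κ i)] {A : (i : ι) → Matrix (κ i) (κ i) ℂ} {q s : ℕ}
    {f : (Fin q → ℝ) → Matrix (Fin s) (Fin s) ℂ} {G : Set (Fin q → ℝ)} (hG : IsCompact G) {R : ℝ}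
    (hA : ∀ i, (A i).IsHermitian) (hAR : ∀ᶠ i in l, ∀ x, ∑ y, ‖A i x y‖ ≤ R)
    (hf : Continuous f) (hfH : ∀ t, (f t).IsHermitian) (hfR : ∀ t x, ∑ y, ‖f t x y‖ ≤ R)
    (hmom : ∀ k : ℕ, Tendsto (fun i => (A i ^ k).trace / (Fintype.card (κ i) : ℂ)) l
      (𝓝 ((1 / (volume.real G : ℂ)) * ∫ t in G, (f t ^ k).trace / (s : ℂ))))
    {F : ℂ → ℂ} (hF : Continuous F) :
    Tendsto (fun i => eigenvalueSum (A i) F / (Fintype.card (κ i) : ℂ)) l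
      (𝓝 ((1 / (volume.real G : ℂ)) * ∫ t in G, eigenvalueSum (f t) F / (s : ℂ))) := by
  have hpoly : ∀ P : Polynomial ℂ,
      Tendsto (fun i => eigenvalueSum (A i) (fun z => P.eval z) / (Fintype.card (κ i) : ℂ)) l
      (𝓝 ((1 / (volume.real G : ℂ)) *
        ∫ t in G, eigenvalueSum (f t) (fun z => P.eval z) / (s : ℂ))) := by
    intro P
    have h1 : ∀ i, eigenvalueSum (A i) (fun z => P.eval z) / (Fintype.card (κ i) : ℂ)
        = ∑ k ∈ Finset.range (P.natDegree + 1),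
          P.coeff k * ((A i ^ k).trace / (Fintype.card (κ i) : ℂ)) := fun i => by
      rw [eigenvalueSum_eval (hA i), Finset.sum_div]
      exact Finset.sum_congr rfl fun k _ => mul_div_assoc _ _ _
    have h2 : ∀ t, eigenvalueSum (f t) (fun z => P.eval z) / (s : ℂ)
        = ∑ k ∈ Finset.range (P.natDegree + 1), P.coeff k * ((f t ^ k).trace / (s : ℂ)) :=
      fun t => by
      rw [eigenvalueSum_eval (hfH t), Finset.sum_div]
      exact Finset.sum_congr rfl fun k _ => mul_div_assoc _ _ _
    simp_rw [h1, h2]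
    rw [integral_finsetSum, Finset.mul_sum]
    · refine tendsto_finsetSum _ fun k _ => ?_
      rw [integral_const_mul, mul_left_comm]
      exact (hmom k).const_mul _
    · intro k _
      exact ContinuousOn.integrableOn_compact hG (Continuous.continuousOn (by fun_prop))
  rw [Metric.tendsto_nhds]
  intro ε hε
  obtain ⟨P, hP⟩ := exists_polynomial_near hF R (show 0 < ε / 3 by positivity)
  have hint : ‖(1 / (volume.real G : ℂ)) * (∫ t in G, eigenvalueSum (f t) F / (s : ℂ))
      - (1 / (volume.real G : ℂ)) * ∫ t in G, eigenvalueSum (f t) (fun z => P.eval z) / (s : ℂ)‖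
      ≤ ε / 3 := by
    rw [← mul_sub, ← integral_sub]
    · rw [norm_mul, norm_div, norm_one, Complex.norm_real, Real.norm_of_nonneg measureReal_nonneg,
        one_div, inv_mul_eq_div]
      refine div_le_of_le_mul₀ measureReal_nonneg (by positivity) ?_
      exact norm_setIntegral_le_of_norm_le_const hG.measure_lt_top fun t _ =>
        norm_eigenvalueSum_div_sub_le (hfH t) (hfR t) (by positivity) hP (Fintype.card_fin s)
    · exact ContinuousOn.integrableOn_compact hG
        (Continuous.continuousOn ((continuous_eigenvalueSum hf hfH hfR hF).div_const _))
    · exact ContinuousOn.integrableOn_compact hG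
        (Continuous.continuousOn ((continuous_eigenvalueSum hf hfH hfR (by fun_prop)).div_const _))
  filter_upwards [hAR, Metric.tendsto_nhds.1 (hpoly P) (ε / 3) (by positivity)] with i hi h2
  have h1 := norm_eigenvalueSum_div_sub_le (F := F) (G := fun z => P.eval z) (hA i) hi
    (show 0 ≤ ε / 3 by positivity) hP rfl
  rw [← dist_eq_norm] at h1 hint
  rw [dist_comm] at hint
  calc _ ≤ _ := dist_triangle4 _ _ _ _
    _ < ε / 3 + ε / 3 + ε / 3 := add_lt_add_of_lt_of_le (add_lt_add_of_le_of_lt h1 h2) hint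
    _ = ε := by ring

end EigenvalueSum

/-! ### Plane waves -/

/-- The character `θ ↦ exp(i ⟨z, θ⟩)`. -/
def planeWave {q : ℕ} (z : Fin q → ℤ) (θ : Fin q → ℝ) : ℂ :=
  ∏ j, Complex.exp (z j * θ j * Complex.I)

lemma planeWave_add {q : ℕ} (z w : Fin q → ℤ) (θ : Fin q → ℝ) :
    planeWave (z + w) θ = planeWave z θ * planeWave w θ := by
  simp only [planeWave, ← Finset.prod_mul_distrib, ← Complex.exp_add, Pi.add_apply]
  refine Finset.prod_congr rfl fun j _ => ?_
  push_cast; ring_nf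

lemma continuous_planeWave {q : ℕ} (z : Fin q → ℤ) : Continuous (planeWave z) := by
  unfold planeWave; fun_prop

lemma integral_exp_int_mul (m : ℤ) :
    ∫ t in Set.Icc (-Real.pi) Real.pi, Complex.exp (m * t * Complex.I)
      = if m = 0 then (2 * Real.pi : ℂ) else 0 := by
  rw [integral_Icc_eq_integral_Ioc,
    ← intervalIntegral.integral_of_le (by linarith [Real.pi_pos])]
  split_ifs with h
  · simp [h]; ring
  · have hc : (m : ℂ) * Complex.I ≠ 0 := mul_ne_zero (by exact_mod_cast h) Complex.I_ne_zero
    simp_rw [mul_right_comm _ _ Complex.I]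
    rw [integral_exp_mul_complex hc, div_eq_zero_iff]
    left
    rw [sub_eq_zero, Complex.exp_eq_exp_iff_exists_int]
    exact ⟨m, by push_cast; ring⟩

lemma integral_planeWave {q : ℕ} (z : Fin q → ℤ) :
    ∫ θ in Set.Icc (fun _ => -Real.pi) (fun _ => Real.pi), planeWave z θ
      = if z = 0 then (2 * Real.pi : ℂ) ^ q else 0 := by
  rw [← Set.pi_univ_Icc, volume_pi, Measure.restrict_pi_pi]
  unfold planeWave
  rw [integral_fintype_prod_eq_prod (fun j (t : ℝ) => Complex.exp (z j * t * Complex.I))]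
  simp_rw [integral_exp_int_mul]
  split_ifs with h
  · simp [h]
  · obtain ⟨j, hj⟩ := Function.ne_iff.1 h
    exact Finset.prod_eq_zero (Finset.mem_univ j) (if_neg (by simpa using hj))

/-! ### Traces of powers of locally Toeplitz matrices -/

lemma volume_real_cube (q : ℕ) :
    volume.real (Set.Icc (fun _ : Fin q => -Real.pi) (fun _ => Real.pi)) = (2 * Real.pi) ^ q := by
  rw [measureReal_def, Real.volume_Icc_pi_toReal (fun _ => by linarith [Real.pi_pos])]
  simp [two_mul]

section LocallyToeplitz

variable {κ : Type*} [Fintype κ] [DecidableEq κ] {q s : ℕ}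

/-- If `A` acts on plane waves as multiplication by the symbol `f` in all rows of the interior, then
so does every power `A ^ k` with the symbol `f ^ k`, further inside. The set of indices that are
deep enough for the `k`-th power is `deep k`; an index carries a component `c` and a lattice
position `x`. -/
lemma pow_apply_eq_integral {A : Matrix κ κ ℂ} {c : κ → Fin s} {x : κ → Fin q → ℤ}
    {f : (Fin q → ℝ) → Matrix (Fin s) (Fin s) ℂ} (hf : Continuous f)
    (hinj : ∀ i j, c i = c j → x i = x j → i = j) {deep : ℕ → κ → Prop}
    (hstep : ∀ k i l, deep (k + 1) i → A i l ≠ 0 → deep k l)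
    (hrow : ∀ k i, deep (k + 1) i → ∀ θ b,
      ∑ l, (if c l = b then A i l * planeWave (x i - x l) θ else 0) = f θ (c i) b)
    (k : ℕ) (i j : κ) (hi : deep k i) :
    (2 * Real.pi : ℂ) ^ q * (A ^ k) i j
      = ∫ θ in Set.Icc (fun _ => -Real.pi) (fun _ => Real.pi),
          (f θ ^ k) (c i) (c j) * planeWave (x j - x i) θ := by
  have hpw : ∀ z : Fin q → ℤ, Continuous (planeWave z) := continuous_planeWave
  induction k generalizing i with
  | zero =>
    simp only [pow_zero, Matrix.one_apply]
    rw [integral_const_mul, integral_planeWave]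
    by_cases hij : i = j
    · simp [hij]
    · by_cases hc : c i = c j
      · have : x j - x i ≠ 0 := fun h => hij (hinj i j hc (sub_eq_zero.1 h).symm)
        simp [hij, this]
      · simp [hij, hc]
  | succ k ih =>
    have hterm : ∀ l, (2 * Real.pi : ℂ) ^ q * (A i l * (A ^ k) l j)
        = ∫ θ in Set.Icc (fun _ => -Real.pi) (fun _ => Real.pi),
          A i l * ((f θ ^ k) (c l) (c j) * planeWave (x j - x l) θ) := by
      intro l
      rw [integral_const_mul]
      by_cases h : A i l = 0
      · simp [h]
      · rw [← ih l (hstep k i l hi h)]; ring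
    rw [pow_succ', Matrix.mul_apply, Finset.mul_sum, Finset.sum_congr rfl fun l _ => hterm l,
      ← integral_finsetSum]
    · congr 1
      funext θ
      have hl : ∀ l, A i l * ((f θ ^ k) (c l) (c j) * planeWave (x j - x l) θ)
          = ∑ b, (if c l = b then A i l * planeWave (x i - x l) θ else 0) *
            ((f θ ^ k) b (c j) * planeWave (x j - x i) θ) := by
        intro l
        simp only [ite_mul, zero_mul, Finset.sum_ite_eq, Finset.mem_univ, if_true]
        rw [show x j - x l = (x i - x l) + (x j - x i) by abel, planeWave_add]
        ring
      simp_rw [hl]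
      rw [Finset.sum_comm]
      simp_rw [← Finset.sum_mul, hrow k i hi, pow_succ', Matrix.mul_apply, Finset.sum_mul, mul_assoc]
    · intro l _
      refine ContinuousOn.integrableOn_compact isCompact_Icc (Continuous.continuousOn ?_)
      fun_prop

/-- The trace of `A ^ k` differs from the moment of the symbol only through the diagonal entries
at indices near the boundary, each of which is at most `R ^ k`. -/
lemma norm_trace_pow_sub_le {A : Matrix κ κ ℂ} {c : κ → Fin s} {x : κ → Fin q → ℤ}
    {f : (Fin q → ℝ) → Matrix (Fin s) (Fin s) ℂ} (hf : Continuous f)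
    (hinj : ∀ i j, c i = c j → x i = x j → i = j) {deep : ℕ → κ → Prop}
    (hstep : ∀ k i l, deep (k + 1) i → A i l ≠ 0 → deep k l)
    (hrow : ∀ k i, deep (k + 1) i → ∀ θ b,
      ∑ l, (if c l = b then A i l * planeWave (x i - x l) θ else 0) = f θ (c i) b)
    {R : ℝ} (hR : 0 ≤ R) (hA : ∀ x, ∑ y, ‖A x y‖ ≤ R) (hfR : ∀ θ a, ∑ b, ‖f θ a b‖ ≤ R)
    (hc : ∀ φ : Fin s → ℂ, s * ∑ i, φ (c i) = Fintype.card κ * ∑ a, φ a)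
    (hs : s ≠ 0) (k : ℕ) :
    ‖(A ^ k).trace - Fintype.card κ * ((1 / (2 * Real.pi : ℂ) ^ q) *
      ∫ θ in Set.Icc (fun _ => -Real.pi) (fun _ => Real.pi), (f θ ^ k).trace / (s : ℂ))‖
      ≤ {i | ¬ deep k i}.ncard * (2 * R ^ k) := by
  classical
  have hπ : (2 * Real.pi : ℂ) ^ q ≠ 0 :=
    pow_ne_zero _ (mul_ne_zero two_ne_zero (by exact_mod_cast Real.pi_ne_zero))
  have hs' : (s : ℂ) ≠ 0 := by exact_mod_cast hs
  set Q : Set (Fin q → ℝ) := Set.Icc (fun _ => -Real.pi) (fun _ => Real.pi) with hQ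
  set μ : Fin s → ℂ := fun a => (1 / (2 * Real.pi : ℂ) ^ q) * ∫ θ in Q, (f θ ^ k) a a with hμ
  have hμR : ∀ a, ‖μ a‖ ≤ R ^ k := by
    intro a
    have hv := volume_real_cube q
    have h1 : ‖∫ θ in Q, (f θ ^ k) a a‖ ≤ R ^ k * volume.real Q :=
      norm_setIntegral_le_of_norm_le_const isCompact_Icc.measure_lt_top fun θ _ =>
        norm_pow_apply_le hR (hfR θ) k a a
    rw [hμ, norm_mul, norm_div, norm_one, norm_pow, norm_mul, Complex.norm_real, Complex.norm_ofNat,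
      Real.norm_of_nonneg Real.pi_pos.le, one_div, inv_mul_eq_div, div_le_iff₀ (by positivity),
      ← hv]
    exact h1
  have htrace : Fintype.card κ * ((1 / (2 * Real.pi : ℂ) ^ q) *
      ∫ θ in Q, (f θ ^ k).trace / (s : ℂ)) = ∑ i, μ (c i) := by
    apply mul_left_cancel₀ hs'
    rw [hc, integral_div]
    simp only [Matrix.trace, Matrix.diag_apply]
    rw [integral_finsetSum, hμ, ← Finset.mul_sum]
    · field_simp
    · intro a _
      exact ContinuousOn.integrableOn_compact isCompact_Icc (Continuous.continuousOn (by fun_prop))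
  have hdeep : ∀ i, deep k i → (A ^ k) i i = μ (c i) := by
    intro i hi
    have h := pow_apply_eq_integral hf hinj hstep hrow k i i hi
    have h0 : ∀ θ : Fin q → ℝ, planeWave (0 : Fin q → ℤ) θ = 1 := fun θ => by simp [planeWave]
    simp only [sub_self, h0, mul_one] at h
    simp only [hμ]
    rw [hQ, ← h]
    field_simp
  rw [htrace, Matrix.trace, ← Finset.sum_sub_distrib]
  have hle : ∀ i, ‖(A ^ k).diag i - μ (c i)‖ ≤ if ¬ deep k i then 2 * R ^ k else 0 := by
    intro i
    split_ifs with h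
    · rw [Matrix.diag_apply, hdeep i h, sub_self, norm_zero]
    · rw [two_mul]
      exact (norm_sub_le _ _).trans (add_le_add (norm_pow_apply_le hR hA k i i) (hμR _))
  refine (norm_sum_le _ _).trans ((Finset.sum_le_sum fun i _ => hle i).trans_eq ?_)
  rw [← Finset.sum_filter, Finset.sum_const, nsmul_eq_mul, Set.ncard_eq_toFinset_card']
  congr 3
  ext i; simp

end LocallyToeplitz

/-- Families of locally Toeplitz matrices with few indices near the boundary have the moments of
their symbol. -/
theorem tendsto_trace_pow {ι : Type*} {l : Filter ι} {κ : ι → Type*}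
    [∀ i, Fintype (κ i)] [∀ i, DecidableEq (κ i)] {A : (i : ι) → Matrix (κ i) (κ i) ℂ} {q s : ℕ}
    {f : (Fin q → ℝ) → Matrix (Fin s) (Fin s) ℂ} (hf : Continuous f)
    {c : (i : ι) → κ i → Fin s} {x : (i : ι) → κ i → Fin q → ℤ} {deep : (i : ι) → ℕ → κ i → Prop}
    {R : ℝ} (hR : 0 ≤ R) (hs : s ≠ 0)
    (hinj : ∀ n i j, c n i = c n j → x n i = x n j → i = j)
    (hc : ∀ n, ∀ φ : Fin s → ℂ, s * ∑ i, φ (c n i) = Fintype.card (κ n) * ∑ a, φ a)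
    (hfR : ∀ θ a, ∑ b, ‖f θ a b‖ ≤ R)
    (hA : ∀ᶠ n in l, ∀ x, ∑ y, ‖A n x y‖ ≤ R)
    (hstep : ∀ᶠ n in l, ∀ k i j, deep n (k + 1) i → A n i j ≠ 0 → deep n k j)
    (hrow : ∀ᶠ n in l, ∀ k i, deep n (k + 1) i → ∀ θ b,
      ∑ j, (if c n j = b then A n i j * planeWave (x n i - x n j) θ else 0) = f θ (c n i) b)
    (hcard : ∀ᶠ n in l, 0 < Fintype.card (κ n))
    (hdeep : ∀ k, Tendsto (fun n => ({i | ¬ deep n k i}.ncard : ℝ) / Fintype.card (κ n)) l (𝓝 0))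
    (k : ℕ) :
    Tendsto (fun n => (A n ^ k).trace / (Fintype.card (κ n) : ℂ)) l
      (𝓝 ((1 / (volume.real (Set.Icc (fun _ : Fin q => -Real.pi) (fun _ => Real.pi)) : ℂ)) *
        ∫ θ in Set.Icc (fun _ => -Real.pi) (fun _ => Real.pi), (f θ ^ k).trace / (s : ℂ))) := by
  rw [volume_real_cube, tendsto_iff_norm_sub_tendsto_zero]
  refine squeeze_zero' (Eventually.of_forall fun _ => norm_nonneg _) ?_
    (by simpa using (hdeep k).mul_const (2 * R ^ k))
  filter_upwards [hA, hstep, hrow, hcard] with n h1 h2 h3 h4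
  have h := norm_trace_pow_sub_le hf (hinj n) h2 h3 hR h1 hfR (hc n) hs k
  have hd : (0 : ℝ) < Fintype.card (κ n) := by exact_mod_cast h4
  have hd' : (Fintype.card (κ n) : ℂ) ≠ 0 := by exact_mod_cast h4.ne'
  simp only [Complex.ofReal_pow, Complex.ofReal_mul, Complex.ofReal_ofNat]
  rw [div_mul_eq_mul_div (_ : ℝ) _ (2 * R ^ k), le_div_iff₀ hd]
  refine le_trans (le_of_eq ?_) h
  rw [← Complex.norm_natCast, ← norm_mul, sub_mul, div_mul_cancel₀ _ hd', mul_comm (_ * _)]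

/-! ### Two-level banded matrices -/

/-- The lattice position of a pair of indices. -/
def position {m₁ m₂ : ℕ} (i : Fin m₁ × Fin m₂) : Fin 2 → ℤ := ![((i.1 : ℕ) : ℤ), ((i.2 : ℕ) : ℤ)]

lemma planeWave_position {m₁ m₂ : ℕ} (i j : Fin m₁ × Fin m₂) (θ : Fin 2 → ℝ) :
    planeWave (position i - position j) θ
      = Complex.exp (((((i.1 : ℕ) : ℤ) - (j.1 : ℕ) : ℤ) : ℂ) * θ 0 * Complex.I)
        * Complex.exp (((((i.2 : ℕ) : ℤ) - (j.2 : ℕ) : ℤ) : ℂ) * θ 1 * Complex.I) := by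
  rw [planeWave, Fin.prod_univ_two]; rfl

/-- A two-level matrix with bandwidth `p` at both levels and absolute row sums at most `K`, which
away from the boundary acts on plane waves as multiplication by `h`. -/
structure IsLocallyToeplitz (p n₁ n₂ : ℕ) (K : ℝ) (h : (Fin 2 → ℝ) → ℂ)
    (E : Matrix (Fin (n₁ + p - 2) × Fin (n₂ + p - 2)) (Fin (n₁ + p - 2) × Fin (n₂ + p - 2)) ℝ) :
    Prop where
  sum_abs_le : ∀ i, ∑ j, |E i j| ≤ K
  band : ∀ i j, E i j ≠ 0 → |((i.1 : ℕ) : ℤ) - (j.1 : ℕ)| ≤ p ∧ |((i.2 : ℕ) : ℤ) - (j.2 : ℕ)| ≤ p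
  row_sum : ∀ i : Fin (n₁ + p - 2) × Fin (n₂ + p - 2), 2 * p ≤ (i.1 : ℕ) → (i.1 : ℕ) + 2 + p ≤ n₁ →
    2 * p ≤ (i.2 : ℕ) → (i.2 : ℕ) + 2 + p ≤ n₂ →
    ∀ θ, ∑ j, (E i j : ℂ) * planeWave (position i - position j) θ = h θ

lemma IsBandedToeplitz.sum_abs_le {p n : ℕ} {C : ℝ} {g : ℤ → ℝ} (hC : 0 ≤ C)
    {B : Matrix (Fin (n + p - 2)) (Fin (n + p - 2)) ℝ} (h : IsBandedToeplitz p n C g B)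
    (i : Fin (n + p - 2)) : ∑ j, |B i j| ≤ (2 * p + 1) * C := by
  classical
  calc ∑ j, |B i j| ≤ ∑ j : Fin (n + p - 2),
        if |((i : ℕ) : ℤ) - (j : ℕ)| ≤ p then C else 0 := by
        refine Finset.sum_le_sum fun j _ => ?_
        split_ifs with hj
        · exact h.abs_apply_le i j
        · rw [h.apply_eq_zero i j (not_le.1 hj), abs_zero]
    _ = (Finset.univ.filter fun j : Fin (n + p - 2) => |((i : ℕ) : ℤ) - (j : ℕ)| ≤ p).card * C := by
        rw [← Finset.sum_filter, Finset.sum_const, nsmul_eq_mul]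
    _ ≤ (2 * p + 1) * C := by
        refine mul_le_mul_of_nonneg_right ?_ hC
        have : (Finset.univ.filter fun j : Fin (n + p - 2) => |((i : ℕ) : ℤ) - (j : ℕ)| ≤ p).card
            ≤ (Finset.Icc (-(p : ℤ)) p).card := by
          refine Finset.card_le_card_of_injOn (fun j => ((i : ℕ) : ℤ) - (j : ℕ)) ?_ ?_
          · intro j hj
            simpa only [Finset.coe_Icc, Set.mem_Icc, Finset.coe_filter, Finset.mem_univ, true_and,
              Set.mem_ofPred_eq, abs_le] using hj
          · intro j _ j' _ hjj
            simp only at hjj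
            exact Fin.ext (by omega)
        rw [Int.card_Icc] at this
        have h2 : ((p : ℤ) + 1 - -(p : ℤ)).toNat = 2 * p + 1 := by omega
        rw [h2] at this
        exact_mod_cast this

/-- Kronecker products of interior Toeplitz matrices act on plane waves as multiplication by the
product of the two generating functions. -/
lemma IsBandedToeplitz.kronecker {p n₁ n₂ : ℕ} (hp : 1 ≤ p) {C : ℝ} {g₁ g₂ : ℤ → ℝ} (hC : 0 ≤ C)
    {B₁ : Matrix (Fin (n₁ + p - 2)) (Fin (n₁ + p - 2)) ℝ}
    {B₂ : Matrix (Fin (n₂ + p - 2)) (Fin (n₂ + p - 2)) ℝ}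
    (h₁ : IsBandedToeplitz p n₁ C g₁ B₁) (h₂ : IsBandedToeplitz p n₂ C g₂ B₂)
    {φ₁ φ₂ : ℝ → ℂ}
    (hφ₁ : ∀ θ : ℝ,
      ∑ k ∈ Finset.Icc (-(p : ℤ)) p, (g₁ k : ℂ) * Complex.exp (k * θ * Complex.I) = φ₁ θ)
    (hφ₂ : ∀ θ : ℝ,
      ∑ k ∈ Finset.Icc (-(p : ℤ)) p, (g₂ k : ℂ) * Complex.exp (k * θ * Complex.I) = φ₂ θ) :
    IsLocallyToeplitz p n₁ n₂ (((2 * p + 1) * C) * ((2 * p + 1) * C))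
      (fun θ => φ₁ (θ 0) * φ₂ (θ 1)) (B₁ ⊗ₖ B₂) where
  sum_abs_le i := by
    have e : ∑ j, |(B₁ ⊗ₖ B₂) i j| = (∑ j, |B₁ i.1 j|) * ∑ j, |B₂ i.2 j| := by
      rw [Finset.sum_mul_sum, Fintype.sum_prod_type]
      refine Finset.sum_congr rfl fun j₁ _ => Finset.sum_congr rfl fun j₂ _ => ?_
      rw [Matrix.kronecker_apply, abs_mul]
    rw [e]
    exact mul_le_mul (h₁.sum_abs_le hC _) (h₂.sum_abs_le hC _)
      (Finset.sum_nonneg fun _ _ => abs_nonneg _) (by positivity)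
  band i j hij := by
    rw [Matrix.kronecker_apply] at hij
    constructor
    · by_contra h
      exact hij (by rw [h₁.apply_eq_zero _ _ (not_le.1 h), zero_mul])
    · by_contra h
      exact hij (by rw [h₂.apply_eq_zero _ _ (not_le.1 h), mul_zero])
  row_sum i a1 a2 a3 a4 θ := by
    rw [← hφ₁, ← hφ₂, ← h₁.row_sum hp i.1 a1 a2, ← h₂.row_sum hp i.2 a3 a4, Finset.sum_mul_sum,
      Fintype.sum_prod_type]
    refine Finset.sum_congr rfl fun j₁ _ => Finset.sum_congr rfl fun j₂ _ => ?_
    rw [planeWave_position, Matrix.kronecker_apply]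
    push_cast; ring

section

variable {p n₁ n₂ : ℕ} {K K' : ℝ} {h h' : (Fin 2 → ℝ) → ℂ}
  {E E' : Matrix (Fin (n₁ + p - 2) × Fin (n₂ + p - 2)) (Fin (n₁ + p - 2) × Fin (n₂ + p - 2)) ℝ}

lemma IsLocallyToeplitz.smul (hE : IsLocallyToeplitz p n₁ n₂ K h E) (a : ℝ) :
    IsLocallyToeplitz p n₁ n₂ (|a| * K) (fun θ => a * h θ) (a • E) where
  sum_abs_le i := by
    simp only [Matrix.smul_apply, smul_eq_mul, abs_mul, ← Finset.mul_sum]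
    exact mul_le_mul_of_nonneg_left (hE.sum_abs_le i) (abs_nonneg a)
  band i j hij := hE.band i j (right_ne_zero_of_mul hij)
  row_sum i a1 a2 a3 a4 θ := by
    rw [← hE.row_sum i a1 a2 a3 a4 θ, Finset.mul_sum]
    refine Finset.sum_congr rfl fun j _ => ?_
    rw [Matrix.smul_apply, smul_eq_mul]; push_cast; ring

lemma IsLocallyToeplitz.add (hE : IsLocallyToeplitz p n₁ n₂ K h E)
    (hE' : IsLocallyToeplitz p n₁ n₂ K' h' E') :
    IsLocallyToeplitz p n₁ n₂ (K + K') (fun θ => h θ + h' θ) (E + E') where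
  sum_abs_le i := by
    refine le_trans ?_ (add_le_add (hE.sum_abs_le i) (hE'.sum_abs_le i))
    rw [← Finset.sum_add_distrib]
    exact Finset.sum_le_sum fun j _ => abs_add_le _ _
  band i j hij := by
    by_cases h0 : E i j = 0
    · exact hE'.band i j fun h1 => hij (by rw [Matrix.add_apply, h0, h1, add_zero])
    · exact hE.band i j h0
  row_sum i a1 a2 a3 a4 θ := by
    rw [← hE.row_sum i a1 a2 a3 a4 θ, ← hE'.row_sum i a1 a2 a3 a4 θ, ← Finset.sum_add_distrib]
    refine Finset.sum_congr rfl fun j _ => ?_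
    rw [Matrix.add_apply]; push_cast; ring

end

/-! ### The blocks of the curl-div matrix -/

/-- The blocks of the curl-div matrix. -/
def curlDivBlock (p : ℕ) (α β : ℝ) (n₁ n₂ : ℕ) (a b : Fin 2) :
    Matrix (Fin (n₁ + p - 2) × Fin (n₂ + p - 2)) (Fin (n₁ + p - 2) × Fin (n₂ + p - 2)) ℝ :=
  (!![α • (massMatrix p n₁ ⊗ₖ stiffnessMatrix p n₂) + β • (stiffnessMatrix p n₁ ⊗ₖ massMatrix p n₂),
      α • -((advectionMatrix p n₁).transpose ⊗ₖ advectionMatrix p n₂)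
        + β • (advectionMatrix p n₁ ⊗ₖ (advectionMatrix p n₂).transpose);
      α • -(advectionMatrix p n₁ ⊗ₖ (advectionMatrix p n₂).transpose)
        + β • ((advectionMatrix p n₁).transpose ⊗ₖ advectionMatrix p n₂),
      α • (stiffnessMatrix p n₁ ⊗ₖ massMatrix p n₂)
        + β • (massMatrix p n₁ ⊗ₖ stiffnessMatrix p n₂)] :
    Matrix (Fin 2) (Fin 2) (Matrix _ _ ℝ)) a b

lemma curlDivMatrix_eq (p : ℕ) (α β : ℝ) (n₁ n₂ : ℕ) :
    curlDivMatrix p α β n₁ n₂ = Matrix.fromBlocks (curlDivBlock p α β n₁ n₂ 0 0)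
      (curlDivBlock p α β n₁ n₂ 0 1) (curlDivBlock p α β n₁ n₂ 1 0)
      (curlDivBlock p α β n₁ n₂ 1 1) := by
  rw [curlDivMatrix, curlMatrix, divMatrix, Matrix.fromBlocks_smul, Matrix.fromBlocks_smul,
    Matrix.fromBlocks_add]
  rfl

lemma massMatrix_transpose (p n : ℕ) : (massMatrix p n).transpose = massMatrix p n := by
  ext i j
  simp only [massMatrix, Matrix.transpose_apply, Matrix.of_apply]
  simp_rw [mul_comm]

lemma stiffnessMatrix_transpose (p n : ℕ) :
    (stiffnessMatrix p n).transpose = stiffnessMatrix p n := by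
  ext i j
  simp only [stiffnessMatrix, Matrix.transpose_apply, Matrix.of_apply]
  simp_rw [mul_comm]

lemma curlDivMatrix_transpose (p : ℕ) (α β : ℝ) (n₁ n₂ : ℕ) :
    (curlDivMatrix p α β n₁ n₂).transpose = curlDivMatrix p α β n₁ n₂ := by
  simp only [curlDivMatrix, curlMatrix, divMatrix, Matrix.transpose_add, Matrix.transpose_smul,
    Matrix.fromBlocks_transpose, Matrix.transpose_neg, ← Matrix.kroneckerMap_transpose,
    massMatrix_transpose, stiffnessMatrix_transpose, Matrix.transpose_transpose]

lemma isHermitian_curlDivMatrix (p : ℕ) (α β : ℝ) (n₁ n₂ : ℕ) :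
    ((curlDivMatrix p α β n₁ n₂).map Complex.ofReal).IsHermitian := by
  refine Matrix.IsHermitian.ext fun i j => ?_
  have h : curlDivMatrix p α β n₁ n₂ j i = curlDivMatrix p α β n₁ n₂ i j :=
    congrFun (congrFun (curlDivMatrix_transpose p α β n₁ n₂) i) j
  rw [Matrix.map_apply, Matrix.map_apply, h]
  exact Complex.conj_ofReal _

/-- Each block is locally Toeplitz with the corresponding entry of the symbol. The fixed ratio
`n₂ / n₁ = ν₂ / ν₁` makes the scaling factors constant. -/
lemma exists_isLocallyToeplitz_curlDivBlock {p : ℕ} (hp : 1 ≤ p) (α β : ℝ) (ν₁ ν₂ : ℚ)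
    (a b : Fin 2) : ∃ K : ℝ, 0 ≤ K ∧ ∀ n₁ n₂ : ℕ, 1 ≤ n₁ → 1 ≤ n₂ →
      (n₂ : ℝ) / n₁ = (ν₂ : ℝ) / ν₁ →
      IsLocallyToeplitz p n₁ n₂ K (fun θ => (curlDivSymbol p α β ν₁ ν₂ θ a b : ℂ))
        (curlDivBlock p α β n₁ n₂ a b) := by
  set C : ℝ := p ^ 2 * 4 ^ p * (p + 1)
  have hC : 0 ≤ C := by positivity
  set L : ℝ := ((2 * p + 1) * C) * ((2 * p + 1) * C) with hL
  have hMS : ∀ n₁ n₂ : ℕ, 1 ≤ n₁ → 1 ≤ n₂ → (n₂ : ℝ) / n₁ = (ν₂ : ℝ) / ν₁ →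
      IsLocallyToeplitz p n₁ n₂ (|(ν₂ : ℝ) / ν₁| * L)
        (fun θ => (((ν₂ : ℝ) / ν₁ : ℝ) : ℂ) * ((symbolM p (θ 0) : ℂ) * (symbolS p (θ 1) : ℂ)))
        (massMatrix p n₁ ⊗ₖ stiffnessMatrix p n₂) := by
    intro n₁ n₂ h₁ h₂ hr
    have h := ((isBandedToeplitz_massMatrix hp h₁).kronecker hp hC
      (isBandedToeplitz_stiffnessMatrix hp h₂) (φ₁ := fun t => (symbolM p t : ℂ))
      (φ₂ := fun t => (symbolS p t : ℂ)) (sum_coeff_mass p) (sum_coeff_stiffness hp)).smul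
      ((ν₂ : ℝ) / ν₁)
    convert h using 1
    have a1 : (n₁ : ℝ) ≠ 0 := by positivity
    have a2 : (n₂ : ℝ) ≠ 0 := by positivity
    rw [Matrix.smul_kronecker, Matrix.kronecker_smul, smul_smul, smul_smul, ← hr,
      show (n₂ : ℝ) / n₁ * n₁ * (n₂ : ℝ)⁻¹ = 1 by field_simp, one_smul]
  have hSM : ∀ n₁ n₂ : ℕ, 1 ≤ n₁ → 1 ≤ n₂ → (n₂ : ℝ) / n₁ = (ν₂ : ℝ) / ν₁ →
      IsLocallyToeplitz p n₁ n₂ (|(ν₁ : ℝ) / ν₂| * L)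
        (fun θ => (((ν₁ : ℝ) / ν₂ : ℝ) : ℂ) * ((symbolS p (θ 0) : ℂ) * (symbolM p (θ 1) : ℂ)))
        (stiffnessMatrix p n₁ ⊗ₖ massMatrix p n₂) := by
    intro n₁ n₂ h₁ h₂ hr
    have h := ((isBandedToeplitz_stiffnessMatrix hp h₁).kronecker hp hC
      (isBandedToeplitz_massMatrix hp h₂) (φ₁ := fun t => (symbolS p t : ℂ))
      (φ₂ := fun t => (symbolM p t : ℂ)) (sum_coeff_stiffness hp) (sum_coeff_mass p)).smul
      ((ν₁ : ℝ) / ν₂)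
    convert h using 1
    have a1 : (n₁ : ℝ) ≠ 0 := by positivity
    have a2 : (n₂ : ℝ) ≠ 0 := by positivity
    rw [Matrix.smul_kronecker, Matrix.kronecker_smul, smul_smul, smul_smul,
      show (ν₁ : ℝ) / ν₂ = n₁ / n₂ by rw [← inv_div, ← hr, inv_div],
      show (n₁ : ℝ) / n₂ * (n₁ : ℝ)⁻¹ * n₂ = 1 by field_simp, one_smul]
  have hAA : ∀ n₁ n₂ : ℕ, 1 ≤ n₁ → 1 ≤ n₂ →
      IsLocallyToeplitz p n₁ n₂ L
        (fun θ => (Complex.I * (symbolA p (θ 0) : ℂ)) * -(Complex.I * (symbolA p (θ 1) : ℂ)))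
        (advectionMatrix p n₁ ⊗ₖ (advectionMatrix p n₂).transpose) := fun n₁ n₂ h₁ h₂ =>
    (isBandedToeplitz_advectionMatrix hp h₁).kronecker hp hC
      (isBandedToeplitz_advectionMatrix hp h₂).transpose
      (φ₁ := fun t => Complex.I * (symbolA p t : ℂ))
      (φ₂ := fun t => -(Complex.I * (symbolA p t : ℂ)))
      (sum_coeff_advection p) (sum_coeff_advection_neg p)
  have hAA' : ∀ n₁ n₂ : ℕ, 1 ≤ n₁ → 1 ≤ n₂ →
      IsLocallyToeplitz p n₁ n₂ L
        (fun θ => -(Complex.I * (symbolA p (θ 0) : ℂ)) * (Complex.I * (symbolA p (θ 1) : ℂ)))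
        ((advectionMatrix p n₁).transpose ⊗ₖ advectionMatrix p n₂) := fun n₁ n₂ h₁ h₂ =>
    (isBandedToeplitz_advectionMatrix hp h₁).transpose.kronecker hp hC
      (isBandedToeplitz_advectionMatrix hp h₂)
      (φ₁ := fun t => -(Complex.I * (symbolA p t : ℂ)))
      (φ₂ := fun t => Complex.I * (symbolA p t : ℂ))
      (sum_coeff_advection_neg p) (sum_coeff_advection p)
  -- the factors `i` and `-i` of the two advection symbols combine to a real sign
  have hI : ∀ u v : ℂ, Complex.I * u * (Complex.I * v) = -(u * v) := fun u v => by
    linear_combination u * v * Complex.I_mul_I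
  have hL0 : 0 ≤ L := by positivity
  fin_cases a <;> fin_cases b
  · refine ⟨|α| * (|(ν₂ : ℝ) / ν₁| * L) + |β| * (|(ν₁ : ℝ) / ν₂| * L), by positivity,
      fun n₁ n₂ h₁ h₂ hr => ?_⟩
    convert ((hMS n₁ n₂ h₁ h₂ hr).smul α).add ((hSM n₁ n₂ h₁ h₂ hr).smul β) using 1
    · funext θ
      simp [curlDivSymbol]
      ring
    · rfl
  · refine ⟨|-α| * L + |β| * L, by positivity, fun n₁ n₂ h₁ h₂ hr => ?_⟩
    convert ((hAA' n₁ n₂ h₁ h₂).smul (-α)).add ((hAA n₁ n₂ h₁ h₂).smul β) using 1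
    · funext θ
      simp only [neg_mul, mul_neg, hI]
      simp [curlDivSymbol]
      ring
    · simp [curlDivBlock]
  · refine ⟨|-α| * L + |β| * L, by positivity, fun n₁ n₂ h₁ h₂ hr => ?_⟩
    convert ((hAA n₁ n₂ h₁ h₂).smul (-α)).add ((hAA' n₁ n₂ h₁ h₂).smul β) using 1
    · funext θ
      simp only [neg_mul, mul_neg, hI]
      simp [curlDivSymbol]
      ring
    · simp [curlDivBlock]
  · refine ⟨|α| * (|(ν₁ : ℝ) / ν₂| * L) + |β| * (|(ν₂ : ℝ) / ν₁| * L), by positivity,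
      fun n₁ n₂ h₁ h₂ hr => ?_⟩
    convert ((hSM n₁ n₂ h₁ h₂ hr).smul α).add ((hMS n₁ n₂ h₁ h₂ hr).smul β) using 1
    · funext θ
      simp [curlDivSymbol]
      ring
    · rfl

/-! ### Regularity of the symbol -/

lemma norm_le_of_sum_exp {p : ℕ} {g : ℤ → ℝ} {φ : ℝ → ℂ}
    (h : ∀ θ : ℝ,
      ∑ k ∈ Finset.Icc (-(p : ℤ)) p, (g k : ℂ) * Complex.exp (k * θ * Complex.I) = φ θ) (θ : ℝ) :
    ‖φ θ‖ ≤ ∑ k ∈ Finset.Icc (-(p : ℤ)) p, |g k| := by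
  rw [← h]
  refine (norm_sum_le _ _).trans_eq (Finset.sum_congr rfl fun k _ => ?_)
  rw [norm_mul, Complex.norm_real, Real.norm_eq_abs,
    show (k : ℂ) * θ * Complex.I = ((k * θ : ℝ) : ℂ) * Complex.I by push_cast; rfl,
    Complex.norm_exp_ofReal_mul_I, mul_one]

lemma exists_abs_curlDivSymbol_le {p : ℕ} (hp : 1 ≤ p) (α β : ℝ) (ν₁ ν₂ : ℚ) :
    ∃ K : ℝ, ∀ θ a b, |curlDivSymbol p α β ν₁ ν₂ θ a b| ≤ K := by
  have hM : ∃ m : ℝ, 0 ≤ m ∧ ∀ t, |symbolM p t| ≤ m := ⟨_, Finset.sum_nonneg fun _ _ => abs_nonneg _,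
    fun t => by simpa using norm_le_of_sum_exp (sum_coeff_mass p) t⟩
  have hS : ∃ m : ℝ, 0 ≤ m ∧ ∀ t, |symbolS p t| ≤ m := ⟨_, Finset.sum_nonneg fun _ _ => abs_nonneg _,
    fun t => by simpa using norm_le_of_sum_exp (sum_coeff_stiffness hp) t⟩
  have hA : ∃ m : ℝ, 0 ≤ m ∧ ∀ t, |symbolA p t| ≤ m := ⟨_, Finset.sum_nonneg fun _ _ => abs_nonneg _,
    fun t => by simpa using norm_le_of_sum_exp (sum_coeff_advection p) t⟩
  obtain ⟨m, hm0, hm⟩ := hM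
  obtain ⟨s, hs0, hs⟩ := hS
  obtain ⟨r, hr0, hr⟩ := hA
  have key : ∀ (e f : ℝ), 0 ≤ e → 0 ≤ f → ∀ (u v c d x y z w : ℝ), |x| ≤ e → |y| ≤ f → |z| ≤ f →
      |w| ≤ e → |u * c * x * y + v * d * z * w| ≤ |u| * |c| * e * f + |v| * |d| * f * e := by
    intro e f he hf u v c d x y z w hx hy hz hw
    refine (abs_add_le _ _).trans ?_
    simp only [abs_mul]
    gcongr
  have key' : ∀ (u x y : ℝ), |x| ≤ r → |y| ≤ r → |-u * x * y| ≤ |u| * r * r := by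
    intro u x y hx hy
    simp only [abs_mul, abs_neg]
    gcongr
  set K₁ := |α| * |(ν₂ : ℝ) / ν₁| * m * s + |β| * |(ν₁ : ℝ) / ν₂| * s * m
  set K₂ := |α| * |(ν₁ : ℝ) / ν₂| * s * m + |β| * |(ν₂ : ℝ) / ν₁| * m * s
  set K₃ := |α - β| * r * r
  have p1 : 0 ≤ K₁ := by positivity
  have p2 : 0 ≤ K₂ := by positivity
  have p3 : 0 ≤ K₃ := by positivity
  refine ⟨K₁ + K₂ + K₃, fun θ a b => ?_⟩
  fin_cases a <;> fin_cases b
  · exact (key m s hm0 hs0 α β _ _ _ _ _ _ (hm _) (hs _) (hs _) (hm _)).trans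
      (show K₁ ≤ _ by linarith)
  · exact (key' (α - β) _ _ (hr _) (hr _)).trans (show K₃ ≤ _ by linarith)
  · exact (key' (α - β) _ _ (hr _) (hr _)).trans (show K₃ ≤ _ by linarith)
  · exact (key s m hs0 hm0 α β _ _ _ _ _ _ (hs _) (hm _) (hm _) (hs _)).trans
      (show K₂ ≤ _ by linarith)

lemma continuous_curlDivSymbol (p : ℕ) (α β : ℝ) (ν₁ ν₂ : ℚ) :
    Continuous fun θ => (curlDivSymbol p α β ν₁ ν₂ θ).map Complex.ofReal := by
  have hM : Continuous (symbolM p) := by unfold symbolM; fun_prop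
  have hS : Continuous (symbolS p) := by unfold symbolS; fun_prop
  have hA : Continuous (symbolA p) := by unfold symbolA; fun_prop
  refine continuous_matrix fun a b => ?_
  simp only [Matrix.map_apply]
  fin_cases a <;> fin_cases b <;> simp [curlDivSymbol] <;> fun_prop

lemma isHermitian_curlDivSymbol (p : ℕ) (α β : ℝ) (ν₁ ν₂ : ℚ) (θ : Fin 2 → ℝ) :
    ((curlDivSymbol p α β ν₁ ν₂ θ).map Complex.ofReal).IsHermitian := by
  refine Matrix.IsHermitian.ext fun a b => ?_
  simp only [Matrix.map_apply]
  fin_cases a <;> fin_cases b <;> simp [curlDivSymbol]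

/-! ### Indices near the boundary -/

/-- The one-dimensional index `i` is so far from the boundary that `k` steps of length at most `p`
reach only indices of interior B-splines, and that this holds with a margin on the left. -/
def Deep (p n k : ℕ) (i : Fin (n + p - 2)) : Prop :=
  k * p + p ≤ (i : ℕ) ∧ (i : ℕ) + 2 + k * p ≤ n

lemma Deep.of_succ {p n k : ℕ} {i j : Fin (n + p - 2)} (h : Deep p n (k + 1) i)
    (hij : |((i : ℕ) : ℤ) - (j : ℕ)| ≤ p) : Deep p n k j := by
  rw [abs_le] at hij
  unfold Deep at *
  rw [add_mul, one_mul] at h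
  omega

lemma Deep.interior {p n k : ℕ} {i : Fin (n + p - 2)} (h : Deep p n (k + 1) i) :
    2 * p ≤ (i : ℕ) ∧ (i : ℕ) + 2 + p ≤ n := by
  unfold Deep at h
  rw [add_mul, one_mul] at h
  omega

lemma ncard_not_deep_le (p n k : ℕ) :
    {i : Fin (n + p - 2) | ¬ Deep p n k i}.ncard ≤ 2 * (k * p + p) := by
  have hsub : Fin.val '' {i : Fin (n + p - 2) | ¬ Deep p n k i}
      ⊆ ((Finset.range (k * p + p) ∪ Finset.Ico (n + p - 2 - (k * p + p)) (n + p - 2) :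
        Finset ℕ) : Set ℕ) := by
    rintro _ ⟨i, hi, rfl⟩
    have hi : ¬ Deep p n k i := hi
    have := i.2
    rw [Finset.mem_coe, Finset.mem_union, Finset.mem_range, Finset.mem_Ico]
    unfold Deep at hi
    omega
  have h := Set.ncard_le_ncard hsub (Finset.finite_toSet _)
  rw [Set.ncard_image_of_injective _ Fin.val_injective, Set.ncard_coe_finset] at h
  refine h.trans ((Finset.card_union_le _ _).trans ?_)
  rw [Finset.card_range, Nat.card_Ico]
  omega

/-- The underlying pair of indices of a row or column index. -/
def pairOf {p n₁ n₂ : ℕ} : Index p n₁ n₂ → Fin (n₁ + p - 2) × Fin (n₂ + p - 2) := Sum.elim id id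

/-- The component (`0` or `1`) of a row or column index. -/
def component {p n₁ n₂ : ℕ} : Index p n₁ n₂ → Fin 2 := Sum.elim (fun _ => 0) (fun _ => 1)

lemma curlDivMatrix_apply (p : ℕ) (α β : ℝ) (n₁ n₂ : ℕ) (i j : Index p n₁ n₂) :
    curlDivMatrix p α β n₁ n₂ i j
      = curlDivBlock p α β n₁ n₂ (component i) (component j) (pairOf i) (pairOf j) := by
  rw [curlDivMatrix_eq]
  rcases i with i | i <;> rcases j with j | j <;> rfl

lemma card_index (p n₁ n₂ : ℕ) :
    Fintype.card (Index p n₁ n₂) = 2 * ((n₁ + p - 2) * (n₂ + p - 2)) := by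
  simp [Index, two_mul]

lemma ncard_not_deep_pair_le (p n₁ n₂ k : ℕ) :
    {i : Index p n₁ n₂ | ¬ (Deep p n₁ k (pairOf i).1 ∧ Deep p n₂ k (pairOf i).2)}.ncard
      ≤ 4 * (k * p + p) * ((n₁ + p - 2) + (n₂ + p - 2)) := by
  set D₁ := {i : Fin (n₁ + p - 2) | ¬ Deep p n₁ k i} with hD₁
  set D₂ := {i : Fin (n₂ + p - 2) | ¬ Deep p n₂ k i} with hD₂
  set S := (D₁ ×ˢ (Set.univ : Set (Fin (n₂ + p - 2)))) ∪
    ((Set.univ : Set (Fin (n₁ + p - 2))) ×ˢ D₂) with hS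
  have hSc : S.ncard ≤ 2 * (k * p + p) * (n₂ + p - 2) + (n₁ + p - 2) * (2 * (k * p + p)) := by
    refine (Set.ncard_union_le _ _).trans ?_
    rw [Set.ncard_prod, Set.ncard_prod, Set.ncard_univ, Set.ncard_univ, Nat.card_fin, Nat.card_fin]
    exact add_le_add (Nat.mul_le_mul_right _ (ncard_not_deep_le p n₁ k))
      (Nat.mul_le_mul_left _ (ncard_not_deep_le p n₂ k))
  have hsub : {i : Index p n₁ n₂ | ¬ (Deep p n₁ k (pairOf i).1 ∧ Deep p n₂ k (pairOf i).2)}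
      ⊆ Sum.inl '' S ∪ Sum.inr '' S := by
    have hmem : ∀ i : Fin (n₁ + p - 2) × Fin (n₂ + p - 2),
        ¬ (Deep p n₁ k i.1 ∧ Deep p n₂ k i.2) → i ∈ S := by
      intro i hi
      rcases not_and_or.1 hi with h | h
      · exact Or.inl ⟨h, Set.mem_univ _⟩
      · exact Or.inr ⟨Set.mem_univ _, h⟩
    rintro (i | i) hi
    · exact Or.inl ⟨i, hmem i hi, rfl⟩
    · exact Or.inr ⟨i, hmem i hi, rfl⟩
  refine (Set.ncard_le_ncard hsub (Set.toFinite _)).trans ((Set.ncard_union_le _ _).trans ?_)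
  refine (add_le_add (Set.ncard_image_le (Set.toFinite _))
    (Set.ncard_image_le (Set.toFinite _))).trans ((add_le_add hSc hSc).trans_eq ?_)
  ring

/-! ### The regime of the mesh sizes -/

lemma tendsto_mesh (ν₁ ν₂ : ℚ) : Tendsto Prod.fst (multiplesAtTop ν₁ ν₂) atTop ∧
    Tendsto Prod.snd (multiplesAtTop ν₁ ν₂) atTop := by
  have h : multiplesAtTop ν₁ ν₂ ≤ atTop ×ˢ atTop := by
    rw [prod_atTop_atTop_eq]; exact inf_le_left
  exact ⟨tendsto_fst.mono_left h, tendsto_snd.mono_left h⟩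

lemma eventually_ratio (ν₁ ν₂ : ℚ) : ∀ᶠ N in multiplesAtTop ν₁ ν₂,
    1 ≤ N.1 ∧ 1 ≤ N.2 ∧ (N.2 : ℝ) / N.1 = (ν₂ : ℝ) / ν₁ := by
  have h1 := (tendsto_mesh ν₁ ν₂).1.eventually_ge_atTop 1
  have h2 := (tendsto_mesh ν₁ ν₂).2.eventually_ge_atTop 1
  have h3 : ∀ᶠ N in multiplesAtTop ν₁ ν₂, ∃ n : ℕ, (N.1 : ℚ) = n * ν₁ ∧ (N.2 : ℚ) = n * ν₂ :=
    mem_inf_of_right (mem_principal_self _)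
  filter_upwards [h1, h2, h3] with N a1 a2 ⟨n, b1, b2⟩
  refine ⟨a1, a2, ?_⟩
  have c1 : (N.1 : ℝ) = n * ν₁ := by exact_mod_cast congrArg (Rat.cast : ℚ → ℝ) b1
  have c2 : (N.2 : ℝ) = n * ν₂ := by exact_mod_cast congrArg (Rat.cast : ℚ → ℝ) b2
  have hn : (n : ℝ) ≠ 0 := by
    rintro h0
    rw [h0, zero_mul] at c1
    have : (1 : ℝ) ≤ N.1 := by exact_mod_cast a1
    linarith
  rw [c1, c2, mul_div_mul_left _ _ hn]

lemma tendsto_size {p : ℕ} (ν₁ ν₂ : ℚ) :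
    Tendsto (fun N : ℕ × ℕ => N.1 + p - 2) (multiplesAtTop ν₁ ν₂) atTop ∧
    Tendsto (fun N : ℕ × ℕ => N.2 + p - 2) (multiplesAtTop ν₁ ν₂) atTop := by
  have h : Tendsto (fun n : ℕ => n + p - 2) atTop atTop :=
    (tendsto_sub_atTop_nat 2).comp (tendsto_add_atTop_nat p)
  exact ⟨h.comp (tendsto_mesh ν₁ ν₂).1, h.comp (tendsto_mesh ν₁ ν₂).2⟩

lemma tendsto_card_index (p : ℕ) (ν₁ ν₂ : ℚ) :
    Tendsto (fun N : ℕ × ℕ => Fintype.card (Index p N.1 N.2)) (multiplesAtTop ν₁ ν₂) atTop := by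
  simp_rw [card_index]
  exact ((tendsto_size ν₁ ν₂).1.atTop_mul_atTop₀ (tendsto_size ν₁ ν₂).2).const_mul_atTop' two_pos

/-- The boundary indices form a set of size `O(n₁ + n₂)` among the `2 (n₁ + p - 2) (n₂ + p - 2)`
indices. -/
lemma tendsto_ncard_not_deep (p : ℕ) (ν₁ ν₂ : ℚ) (k : ℕ) :
    Tendsto (fun N : ℕ × ℕ => ({i : Index p N.1 N.2 |
        ¬ (Deep p N.1 k (pairOf i).1 ∧ Deep p N.2 k (pairOf i).2)}.ncard : ℝ)
        / Fintype.card (Index p N.1 N.2)) (multiplesAtTop ν₁ ν₂) (𝓝 0) := by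
  obtain ⟨t1, t2⟩ := tendsto_size (p := p) ν₁ ν₂
  have i1 := tendsto_inv_atTop_nhds_zero_nat (𝕜 := ℝ) |>.comp t1
  have i2 := tendsto_inv_atTop_nhds_zero_nat (𝕜 := ℝ) |>.comp t2
  have hlim := (i2.add i1).const_mul (2 * ((k : ℝ) * p + p))
  rw [add_zero, mul_zero] at hlim
  refine squeeze_zero' (Eventually.of_forall fun _ => by positivity) ?_ hlim
  filter_upwards [t1.eventually_ge_atTop 1, t2.eventually_ge_atTop 1] with N h1 h2
  have h := ncard_not_deep_pair_le p N.1 N.2 k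
  rw [card_index]
  simp only [Function.comp_apply]
  set m₁ := N.1 + p - 2
  set m₂ := N.2 + p - 2
  have p1 : (0 : ℝ) < m₁ := by exact_mod_cast h1
  have p2 : (0 : ℝ) < m₂ := by exact_mod_cast h2
  have h' : ({i : Index p N.1 N.2 |
        ¬ (Deep p N.1 k (pairOf i).1 ∧ Deep p N.2 k (pairOf i).2)}.ncard : ℝ)
      ≤ 4 * (k * p + p) * (m₁ + m₂) := by exact_mod_cast h
  have key : ∀ a b c : ℝ, 0 < a → 0 < b →
      4 * c * (a + b) = 2 * c * (b⁻¹ + a⁻¹) * (2 * (a * b)) := by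
    intro a b c ha hb
    field_simp
    ring
  push_cast
  rw [div_le_iff₀ (by positivity)]
  exact h'.trans_eq (key _ _ _ p1 p2)

/-! ### The spectral symbol -/

/-- A uniform bound for the absolute row sums, hence for the spectral radius. -/
lemma row_sum_norm_curlDivMatrix_le {p : ℕ} {α β : ℝ} {n₁ n₂ : ℕ} {K : Fin 2 → Fin 2 → ℝ}
    {h : Fin 2 → Fin 2 → (Fin 2 → ℝ) → ℂ}
    (hE : ∀ a b, IsLocallyToeplitz p n₁ n₂ (K a b) (h a b) (curlDivBlock p α β n₁ n₂ a b))
    (hK : ∀ a b, 0 ≤ K a b) (i : Index p n₁ n₂) :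
    ∑ j, ‖((curlDivMatrix p α β n₁ n₂).map Complex.ofReal) i j‖ ≤ ∑ a, ∑ b, K a b := by
  calc _ = ∑ b, ∑ j, |curlDivBlock p α β n₁ n₂ (component i) b (pairOf i) j| := by
        rw [Fintype.sum_sum_type, Fin.sum_univ_two]
        simp only [Matrix.map_apply, Complex.norm_real, Real.norm_eq_abs, curlDivMatrix_apply]
        rfl
    _ ≤ ∑ b, K (component i) b := Finset.sum_le_sum fun b _ => (hE _ b).sum_abs_le _
    _ ≤ _ := Finset.single_le_sum (f := fun a => ∑ b, K a b)
        (fun a _ => Finset.sum_nonneg fun b _ => hK a b) (Finset.mem_univ _)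

end CurlDiv

end

open CurlDiv in
theorem mainTheorem1 (p : ℕ) (hp : 1 ≤ p) (α β : ℝ) (ν₁ ν₂ : ℚ) (hν₁ : 0 < ν₁) (hν₂ : 0 < ν₂) :
    CurlDiv.SpectralSymbol (CurlDiv.multiplesAtTop ν₁ ν₂)
      (κ := fun N : ℕ × ℕ => CurlDiv.Index p N.1 N.2)
      (fun N : ℕ × ℕ => (CurlDiv.curlDivMatrix p α β N.1 N.2).map Complex.ofReal)
      (fun θ : Fin 2 → ℝ => (CurlDiv.curlDivSymbol p α β ν₁ ν₂ θ).map Complex.ofReal)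
      (Set.Icc (fun _ => -Real.pi) (fun _ => Real.pi)) := by
  have hvol : MeasureTheory.volume.real
      (Set.Icc (fun _ : Fin 2 => -Real.pi) (fun _ => Real.pi)) = (2 * Real.pi) ^ 2 :=
    volume_real_cube 2
  have hf := continuous_curlDivSymbol p α β ν₁ ν₂
  have hfH := isHermitian_curlDivSymbol p α β ν₁ ν₂
  choose K hK0 hK using exists_isLocallyToeplitz_curlDivBlock hp α β ν₁ ν₂
  obtain ⟨Kf, hKf⟩ := exists_abs_curlDivSymbol_le hp α β ν₁ ν₂
  -- a common bound for the row sums of the matrices and of the symbol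
  set R : ℝ := max (∑ a, ∑ b, K a b) (2 * Kf) with hR
  have hR0 : 0 ≤ R := le_trans (Finset.sum_nonneg fun a _ => Finset.sum_nonneg fun b _ => hK0 a b)
    (le_max_left _ _)
  have hfR : ∀ (θ : Fin 2 → ℝ) (a : Fin 2),
      ∑ b, ‖((curlDivSymbol p α β ν₁ ν₂ θ).map Complex.ofReal) a b‖ ≤ R := by
    intro θ a
    refine le_trans ?_ (le_max_right _ _)
    simp only [Matrix.map_apply, Complex.norm_real, Real.norm_eq_abs, Fin.sum_univ_two]
    linarith [hKf θ a 0, hKf θ a 1]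
  have hAR : ∀ᶠ N : ℕ × ℕ in multiplesAtTop ν₁ ν₂, ∀ i : Index p N.1 N.2,
      ∑ j, ‖((curlDivMatrix p α β N.1 N.2).map Complex.ofReal) i j‖ ≤ R := by
    filter_upwards [eventually_ratio ν₁ ν₂] with N hN i
    exact (row_sum_norm_curlDivMatrix_le (fun a b => hK a b N.1 N.2 hN.1 hN.2.1 hN.2.2) hK0 i).trans
      (le_max_left _ _)
  have hmom := tendsto_trace_pow (l := multiplesAtTop ν₁ ν₂)
    (κ := fun N : ℕ × ℕ => Index p N.1 N.2)
    (A := fun N : ℕ × ℕ => (curlDivMatrix p α β N.1 N.2).map Complex.ofReal) hf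
    (c := fun _ => component) (x := fun _ i => position (pairOf i))
    (deep := fun N k i => Deep p N.1 k (pairOf i).1 ∧ Deep p N.2 k (pairOf i).2)
    hR0 two_ne_zero
    (by
      intro N i j hc hx
      have h0 := congrFun hx 0
      have h1 := congrFun hx 1
      simp only [position, Matrix.cons_val_zero, Matrix.cons_val_one, Nat.cast_inj] at h0 h1
      have hp : pairOf i = pairOf j := Prod.ext (Fin.ext h0) (Fin.ext h1)
      rcases i with i | i <;> rcases j with j | j
      · exact congrArg Sum.inl hp
      · exact absurd hc (by simp [component])
      · exact absurd hc (by simp [component])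
      · exact congrArg Sum.inr hp)
    (by
      intro N φ
      rw [Fintype.sum_sum_type, Fin.sum_univ_two, card_index]
      simp [component]
      ring)
    hfR hAR
    (by
      filter_upwards [eventually_ratio ν₁ ν₂] with N hN k i j hd hij
      rw [Matrix.map_apply, curlDivMatrix_apply] at hij
      have hb := (hK _ _ N.1 N.2 hN.1 hN.2.1 hN.2.2).band _ _
        (fun h => hij (by rw [h, Complex.ofReal_zero]))
      exact ⟨hd.1.of_succ hb.1, hd.2.of_succ hb.2⟩)
    (by
      filter_upwards [eventually_ratio ν₁ ν₂] with N hN k i hd θ b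
      have h := (hK (component i) b N.1 N.2 hN.1 hN.2.1 hN.2.2).row_sum (pairOf i)
        hd.1.interior.1 hd.1.interior.2 hd.2.interior.1 hd.2.interior.2 θ
      rw [Matrix.map_apply, ← h, Fintype.sum_sum_type]
      simp only [Matrix.map_apply, curlDivMatrix_apply]
      fin_cases b <;> simp [component, pairOf])
    ((tendsto_card_index p ν₁ ν₂).eventually_gt_atTop 0)
    (tendsto_ncard_not_deep p ν₁ ν₂)
  refine ⟨measurableSet_Icc, ?_, isCompact_Icc.measure_lt_top, ?_, tendsto_card_index p ν₁ ν₂, ?_,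
    ?_⟩
  · rw [MeasureTheory.measureReal_def] at hvol
    refine (ENNReal.toReal_pos_iff.1 ?_).1
    rw [hvol]
    have := Real.pi_pos
    positivity
  · intro i j
    exact (hf.matrix_elem i j).measurable.comp measurable_subtype_coe
  · intro F hF _
    exact ContinuousOn.integrableOn_compact isCompact_Icc
      ((continuous_eigenvalueSum hf hfH hfR hF).div_const _).continuousOn
  · intro F hF _
    exact tendsto_eigenvalueSum_of_moments isCompact_Icc
      (fun N => isHermitian_curlDivMatrix p α β N.1 N.2) hAR hf hfH hfR hmom hF
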